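/- Let $d\ge 1$ and $m\in\{0,1\}$ be integers, let $C=\{x\in\mathbb R^d : x_i>0 \text{ for } i\le m\}$, and write $\|\cdot\|_\infty$ for the norm of the real space $L_\infty(C)$ (with Lebesgue measure). For $f\in L_\infty(C)$ let $\partial_{\mathbf I}f=\frac{\partial^d f}{\partial x_1\cdots\partial x_d}$ in the sense of distributions on $C$. Let $W^{1,\infty}(C)$ be the space of all $g\in L_\infty(C)$ whose first-order distributional partial derivatives all belong to $L_\infty(C)$, and let $|z|_1=\sum_{i=1}^d|z_i|$ for $z\in\mathbb R^d$. Put $$\mathfrak M=\{f\in L_\infty(C) : \partial_{\mathbf I}f\in W^{1,\infty}(C),\ \|\,|\nabla\partial_{\mathbf I}f|_1\,\|_\infty\le 1\},$$ and let $\mathcal L$ be the space of all bounded linear operators $S\colon L_\infty(C)\to L_\infty(C)$, with the operator norm. For $\delta>0$ and $N>0$ define the modulus of continuity, the error of optimal recovery by linear operators, and the best approximation by operators of norm at most $N$ as $$\Omega(\delta)=\sup\{\|\partial_{\mathbf I}f\|_\infty : f\in\mathfrak M,\ \|f\|_\infty\le\delta\},$$ $$\mathcal E_\delta=\inf_{S\in\mathcal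 L}\ \sup\{\|\partial_{\mathbf I}f-S\eta\|_\infty : f\in\mathfrak M,\ \eta\in L_\infty(C),\ \|f-\eta\|_\infty\le\delta\},$$ $$E_N=\inf_{S\in\mathcal L,\ \|S\|\le N}\ \sup\{\|\partial_{\mathbf I}f-Sf\|_\infty : f\in\mathfrak M\}.$$ Then for all $\delta>0$ and $N>0$ $$\mathcal E_\delta=\Omega(\delta)=\bigl(2^m(d+1)\delta\bigr)^{\frac1{d+1}},\qquad E_N=\frac d{d+1}\Bigl(\frac{2^m}{N}\Bigr)^{\frac1d}.$$ -/

import Mathlib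

open MeasureTheory TopologicalSpace
open scoped ENNReal Distributions LineDeriv

noncomputable section

namespace Stechkin

/-! ### Extremal problems for an operator on a class of elements

`A : X → Y` need not be linear or bounded, and only its values on the class `M` are used. All
suprema and infima are taken in `[0, ∞]`. -/

section Abstract

variable {X Y : Type*} [SeminormedAddCommGroup X] [NormedSpace ℝ X]
  [NormedAddCommGroup Y] [NormedSpace ℝ Y]

/-- The modulus of continuity `Ω(A, M; δ) = sup {‖A x‖ : x ∈ M, ‖x‖ ≤ δ}`. -/
def modulus (A : X → Y) (M : Set X) (δ : ℝ) : ℝ≥0∞ :=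
  ⨆ x ∈ M, ⨆ _ : ‖x‖ ≤ δ, ‖A x‖ₑ

/-- The deviation `U(A, S; M) = sup {‖A x - S x‖ : x ∈ M}`. -/
def deviation (A : X → Y) (S : X →L[ℝ] Y) (M : Set X) : ℝ≥0∞ :=
  ⨆ x ∈ M, ‖A x - S x‖ₑ

/-- The best approximation of `A` on `M` by bounded linear operators of norm at most `N`. -/
def bestApprox (A : X → Y) (M : Set X) (N : ℝ) : ℝ≥0∞ :=
  ⨅ (S : X →L[ℝ] Y) (_ : ‖S‖ ≤ N), deviation A S M

/-- The deviation of `S` from `A` on the class `M` whose elements are known with error `δ`: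
`sup {‖A x - S η‖ : x ∈ M, η ∈ X, ‖x - η‖ ≤ δ}`. -/
def recoveryDeviation (A : X → Y) (S : X →L[ℝ] Y) (M : Set X) (δ : ℝ) : ℝ≥0∞ :=
  ⨆ x ∈ M, ⨆ η : X, ⨆ _ : ‖x - η‖ ≤ δ, ‖A x - S η‖ₑ

/-- The error of optimal recovery of `A` by bounded linear operators on the class `M` whose
elements are known with error `δ`. -/
def optimalRecovery (A : X → Y) (M : Set X) (δ : ℝ) : ℝ≥0∞ :=
  ⨅ S : X →L[ℝ] Y, recoveryDeviation A S M δ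

end Abstract

/-! ### Distributional derivatives in `L_∞(Ω)` -/

section Derivatives

variable {d : ℕ}

/-- The space `L_∞(Ω)` of essentially bounded real functions on the open set `Ω ⊆ ℝ^d`. -/
abbrev Linfty (Ω : Opens (Fin d → ℝ)) : Type :=
  Lp ℝ ∞ (volume.restrict (Ω : Set (Fin d → ℝ)))

/-- The `i`-th vector of the standard basis of `ℝ^d`. -/
def stdVec (i : Fin d) : Fin d → ℝ := Pi.single i 1

/-- `g` is the distributional partial derivative `∂f/∂x_i` on `Ω`. -/
def IsPartialDeriv (Ω : Opens (Fin d → ℝ)) (i : Fin d) (f g : Linfty Ω) : Prop :=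
  ∀ φ : 𝓓(Ω, ℝ),
    ∫ x in (Ω : Set (Fin d → ℝ)), f x * (∂_{stdVec i} φ) x =
      -∫ x in (Ω : Set (Fin d → ℝ)), g x * φ x

/-- `g` is the distributional mixed derivative `∂^d f / ∂x_1 ⋯ ∂x_d` on `Ω`. -/
def IsMixedDeriv (Ω : Opens (Fin d → ℝ)) (f g : Linfty Ω) : Prop :=
  ∀ φ : 𝓓(Ω, ℝ),
    ∫ x in (Ω : Set (Fin d → ℝ)), f x * (∂^{stdVec (d := d)} φ) x =
      (-1) ^ d * ∫ x in (Ω : Set (Fin d → ℝ)), g x * φ x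

/-- An element of `L_∞(Ω)` is determined by its integrals against test functions. -/
theorem Linfty.eq_of_integral_eq {Ω : Opens (Fin d → ℝ)} {g g' : Linfty Ω}
    (h : ∀ φ : 𝓓(Ω, ℝ), ∫ x in (Ω : Set (Fin d → ℝ)), g x * φ x =
      ∫ x in (Ω : Set (Fin d → ℝ)), g' x * φ x) : g = g' := by
  have key : ∀ k : Linfty Ω, LocallyIntegrable k (volume.restrict (Ω : Set (Fin d → ℝ))) :=
    fun k => (Lp.memLp k).locallyIntegrable le_top
  apply Lp.ext
  have hsub : ∀ᵐ x ∂(volume.restrict (Ω : Set (Fin d → ℝ))),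
      x ∈ (Ω : Set (Fin d → ℝ)) → (g - g' : (Fin d → ℝ) → ℝ) x = 0 := by
    refine Ω.isOpen.ae_eq_zero_of_integral_contDiff_smul_eq_zero
      (((key g).sub (key g')).locallyIntegrableOn _) ?_
    intro φ hφ hc hs
    have h1 := h ⟨φ, by exact_mod_cast hφ, hc, hs⟩
    simp only [TestFunction.coe_mk] at h1
    simp only [Pi.sub_apply, smul_eq_mul, mul_sub]
    rw [integral_sub, sub_eq_zero]
    · simpa only [mul_comm] using h1
    · exact (key g).integrable_smul_left_of_hasCompactSupport hφ.continuous hc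
    · exact (key g').integrable_smul_left_of_hasCompactSupport hφ.continuous hc
  filter_upwards [hsub, ae_restrict_mem Ω.isOpen.measurableSet] with x hx hxΩ
  exact sub_eq_zero.mp (hx hxΩ)

open Classical in
/-- The operator `∂/∂x_i`; its value is `0` by convention where the distributional derivative is
not in `L_∞(Ω)`. -/
def partialDeriv (Ω : Opens (Fin d → ℝ)) (i : Fin d) (f : Linfty Ω) : Linfty Ω :=
  if h : ∃ g, IsPartialDeriv Ω i f g then h.choose else 0

open Classical in
/-- The operator `∂_I = ∂^d / ∂x_1 ⋯ ∂x_d`; its value is `0` by convention where the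
distributional derivative is not in `L_∞(Ω)`. -/
def mixedDeriv (Ω : Opens (Fin d → ℝ)) (f : Linfty Ω) : Linfty Ω :=
  if h : ∃ g, IsMixedDeriv Ω f g then h.choose else 0

theorem IsPartialDeriv.partialDeriv_eq {Ω : Opens (Fin d → ℝ)} {i : Fin d} {f g : Linfty Ω}
    (h : IsPartialDeriv Ω i f g) : partialDeriv Ω i f = g := by
  have hex : ∃ g, IsPartialDeriv Ω i f g := ⟨g, h⟩
  rw [partialDeriv, dif_pos hex]
  exact Linfty.eq_of_integral_eq fun φ =>
    neg_injective ((hex.choose_spec φ).symm.trans (h φ))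

theorem IsMixedDeriv.mixedDeriv_eq {Ω : Opens (Fin d → ℝ)} {f g : Linfty Ω}
    (h : IsMixedDeriv Ω f g) : mixedDeriv Ω f = g := by
  have hex : ∃ g, IsMixedDeriv Ω f g := ⟨g, h⟩
  rw [mixedDeriv, dif_pos hex]
  exact Linfty.eq_of_integral_eq fun φ =>
    mul_left_cancel₀ (pow_ne_zero d (by norm_num : (-1 : ℝ) ≠ 0))
      ((hex.choose_spec φ).symm.trans (h φ))

/-- The Sobolev space `W^{1,∞}(Ω)`. -/
def sobolev (Ω : Opens (Fin d → ℝ)) : Set (Linfty Ω) :=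
  {f | ∀ i, ∃ g, IsPartialDeriv Ω i f g}

/-- The space of all `f ∈ L_∞(Ω)` such that `∂_I f ∈ W^{1,∞}(Ω)`. -/
def mixedSobolev (Ω : Opens (Fin d → ℝ)) : Set (Linfty Ω) :=
  {f | ∃ g ∈ sobolev Ω, IsMixedDeriv Ω f g}

/-- The norm `‖ |∇f|_1 ‖_∞` for `f ∈ W^{1,∞}(Ω)`, where `|z|_1 = |z_1| + ⋯ + |z_d|`. -/
def gradNorm (Ω : Opens (Fin d → ℝ)) (f : Linfty Ω) : ℝ≥0∞ :=
  eLpNorm (fun x => ∑ i, |partialDeriv Ω i f x|) ∞ (volume.restrict (Ω : Set (Fin d → ℝ)))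

/-- The class of all `f ∈ L_∞(Ω)` with `∂_I f ∈ W^{1,∞}(Ω)` and `‖ |∇ ∂_I f|_1 ‖_∞ ≤ 1`. -/
def mixedClass (Ω : Opens (Fin d → ℝ)) : Set (Linfty Ω) :=
  {f | f ∈ mixedSobolev Ω ∧ gradNorm Ω (mixedDeriv Ω f) ≤ 1}

end Derivatives

/-- The open cone `ℝ_+^m × ℝ^{d-m}`, where the first `m` coordinates are positive. -/
def cone (d m : ℕ) : Opens (Fin d → ℝ) where
  carrier := {x | ∀ i : Fin d, (i : ℕ) < m → 0 < x i}
  is_open' := by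
    simp only [Set.ofPred_forall]
    exact isOpen_iInter_of_finite fun i => isOpen_iInter_of_finite fun _ =>
      isOpen_lt continuous_const (continuous_apply i)

end Stechkin

end

noncomputable section

namespace Stechkin

/-! ### Calculus of test functions: translates and integrals of derivatives over orthants. -/

section TestFunctions

variable {d : ℕ} {Ω : Opens (Fin d → ℝ)}

/-! Write `A` for the mixed derivative. For each `h > 0` the proof produces an operator `S` with
norm at most `N = 2^m / h^d` and deviation at most `ε = d / (d+1) * h` on the class, and an element
`f` of the class with `‖f‖ ≤ δ = h^(d+1) / (2^m (d+1))` and `‖A f‖ ≥ h`. These constants satisfy `ε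
+ N δ = h`. Hence `h ≤ Ω(δ) ≤ 𝓔_δ ≤ ε + N δ = h`, and `ε = h - N δ ≤ E_N ≤ ε`; solving for `h` in
terms of `δ` or `N` gives both formulas.

The operator (`exists_approx_mixedDeriv`) is the mixed difference over the box with sides `[0, h]`
in the first `m` coordinates and `[-h, h]` in the others, divided by the volume. It has `2^d`
vertices, which gives the norm. It equals the mean of the translates of `A f` over the box. Since
the `ℓ_1`-norm of the gradient is dual to the sup-norm of the shift, the error is at most the mean
of `‖y‖` over the box, which is `d / (d+1) * h`.

The extremal element (`exists_extremal`) is a primitive of the tent `max (h - ‖y‖) 0`, which is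
1-Lipschitz for the sup-norm. In a full-line coordinate one integrates from `0`; in a half-line
coordinate one takes half the difference of the integrals to the left and to the right of the point.
The kernel is then at most `2^(-m)` in absolute value and, for given `x`, lives on a single orthant,
over which the tent has integral `h^(d+1) / (d+1)`.

All identities are tested against smooth functions, so no continuous representatives are needed. -/

theorem lineDerivOp_eq_fderiv (φ : 𝓓(Ω, ℝ)) (v x : Fin d → ℝ) :
    (∂_{v} φ) x = fderiv ℝ φ x v := by
  rw [TestFunction.lineDerivOp_eq_lineDerivCLM (𝕜 := ℝ),
    TestFunction.lineDerivCLM_eq_fderivCLM, TestFunction.fderivCLM_apply,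
    if_pos (by simp)]

theorem differentiable_testFunction (φ : 𝓓(Ω, ℝ)) : Differentiable ℝ φ :=
  φ.contDiff.differentiable (by simp)

theorem integrable_testFunction (φ : 𝓓(Ω, ℝ)) : Integrable φ :=
  φ.continuous.integrable_of_hasCompactSupport φ.hasCompactSupport

theorem testFunction_eq_zero (φ : 𝓓(Ω, ℝ)) {x : Fin d → ℝ} (hx : x ∉ Ω) : φ x = 0 :=
  image_eq_zero_of_notMem_tsupport fun h => hx (φ.tsupport_subset h)

/-- The translate `x ↦ φ (x - y)` of a test function on a set that is invariant under `· + y`. -/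
def translate (φ : 𝓓(Ω, ℝ)) (y : Fin d → ℝ) (hy : ∀ x ∈ Ω, x + y ∈ Ω) : 𝓓(Ω, ℝ) where
  toFun x := φ (x - y)
  contDiff' := φ.contDiff.comp (contDiff_id.sub contDiff_const)
  hasCompactSupport' := φ.hasCompactSupport.comp_homeomorph (Homeomorph.subRight y)
  tsupport_subset' := by
    intro x hx
    have h1 : x - y ∈ tsupport φ :=
      tsupport_comp_subset_preimage (φ : (Fin d → ℝ) → ℝ) (f := fun x => x - y)
        (by fun_prop) hx
    simpa using hy _ (φ.tsupport_subset h1)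

@[simp] theorem translate_apply (φ : 𝓓(Ω, ℝ)) (y : Fin d → ℝ) (hy : ∀ x ∈ Ω, x + y ∈ Ω)
    (x : Fin d → ℝ) : translate φ y hy x = φ (x - y) := rfl

theorem lineDerivOp_translate (φ : 𝓓(Ω, ℝ)) (y : Fin d → ℝ) (hy : ∀ x ∈ Ω, x + y ∈ Ω)
    (v : Fin d → ℝ) : ∂_{v} (translate φ y hy) = translate (∂_{v} φ) y hy := by
  ext x
  rw [translate_apply, lineDerivOp_eq_fderiv, lineDerivOp_eq_fderiv]
  have : (translate φ y hy : (Fin d → ℝ) → ℝ) = fun x => φ (x - y) := rfl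
  simp only [this, sub_eq_add_neg, fderiv_comp_add_right]

theorem iteratedLineDerivOp_translate (φ : 𝓓(Ω, ℝ)) (y : Fin d → ℝ) (hy : ∀ x ∈ Ω, x + y ∈ Ω)
    {n : ℕ} (v : Fin n → Fin d → ℝ) : ∂^{v} (translate φ y hy) = translate (∂^{v} φ) y hy := by
  induction n with
  | zero => simp
  | succ n ih =>
    rw [LineDeriv.iteratedLineDerivOp_succ_left, ih, lineDerivOp_translate,
      ← LineDeriv.iteratedLineDerivOp_succ_left]

/-- Independence makes the affine parametrization a closed embedding, so compact support is
inherited. -/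
theorem integrable_comp_add_sum (φ : 𝓓(Ω, ℝ)) {n : ℕ} {v : Fin n → Fin d → ℝ}
    (hv : LinearIndependent ℝ v) (c : Fin d → ℝ) :
    Integrable fun y : Fin n → ℝ => φ (c + ∑ i, y i • v i) := by
  have hemb : Topology.IsClosedEmbedding fun y : Fin n → ℝ => c + ∑ i, y i • v i := by
    have h1 : Topology.IsClosedEmbedding (Fintype.linearCombination ℝ v) :=
      LinearMap.isClosedEmbedding_of_injective
        (LinearMap.ker_eq_bot.2 (LinearIndependent.fintypeLinearCombination_injective hv))
    exact (Homeomorph.addLeft c).isClosedEmbedding.comp h1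
  exact (φ.continuous.comp hemb.continuous).integrable_of_hasCompactSupport
    (φ.hasCompactSupport.comp_isClosedEmbedding hemb)

theorem integral_Ioi_lineDerivOp (φ : 𝓓(Ω, ℝ)) {v : Fin d → ℝ} (hv : v ≠ 0) (c : Fin d → ℝ) :
    ∫ t in Set.Ioi (0 : ℝ), (∂_{v} φ) (c + t • v) = -φ c := by
  have hemb : Topology.IsClosedEmbedding fun t : ℝ => c + t • v :=
    (Homeomorph.addLeft c).isClosedEmbedding.comp (isClosedEmbedding_smul_left hv)
  have hd : ∀ t : ℝ, HasDerivAt (fun t : ℝ => φ (c + t • v)) ((∂_{v} φ) (c + t • v)) t := by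
    intro t
    rw [lineDerivOp_eq_fderiv]
    have h2 : HasDerivAt (fun t : ℝ => c + t • v) v t := by
      simpa using ((hasDerivAt_id t).smul_const v).const_add c
    exact ((differentiable_testFunction φ _).hasFDerivAt).comp_hasDerivAt t h2
  have hc : HasCompactSupport fun t : ℝ => φ (c + t • v) :=
    φ.hasCompactSupport.comp_isClosedEmbedding hemb
  have hs : ContDiff ℝ 1 fun t : ℝ => φ (c + t • v) :=
    (φ.contDiff.of_le (by simp)).comp (by fun_prop)
  have := hc.integral_Ioi_deriv_eq hs 0
  simpa [(hd _).deriv] using this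

/-- Each integration along a ray removes one derivative and contributes a sign. Arbitrary
independent families are allowed because the induction passes to the tail of `v`. -/
theorem integral_orthant_iteratedLineDerivOp (φ : 𝓓(Ω, ℝ)) {n : ℕ} {v : Fin n → Fin d → ℝ}
    (hv : LinearIndependent ℝ v) (c : Fin d → ℝ) :
    ∫ y in Set.univ.pi fun _ : Fin n => Set.Ioi (0 : ℝ), (∂^{v} φ) (c + ∑ i, y i • v i) =
      (-1) ^ n * φ c := by
  induction n with
  | zero =>
    have : (Set.univ.pi fun _ : Fin 0 => Set.Ioi (0 : ℝ)) = Set.univ := by ext; simp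
    simp [this, measureReal_def, volume_pi]
  | succ n ih =>
    have hv' : LinearIndependent ℝ (Fin.tail v) := hv.comp _ (Fin.succ_injective n)
    have hv0 : v 0 ≠ 0 := hv.ne_zero 0
    set ψ := ∂^{Fin.tail v} φ with hψ
    set e := MeasurableEquiv.piFinSuccAbove (fun _ : Fin (n + 1) => ℝ) 0
    have he : MeasurePreserving e.symm :=
      (volume_preserving_piFinSuccAbove (fun _ : Fin (n + 1) => ℝ) 0).symm
    have hpre : e.symm ⁻¹' (Set.univ.pi fun _ : Fin (n + 1) => Set.Ioi (0 : ℝ)) =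
        Set.Ioi (0 : ℝ) ×ˢ (Set.univ.pi fun _ : Fin n => Set.Ioi (0 : ℝ)) := by
      ext ⟨t, y⟩
      simp [e, MeasurableEquiv.piFinSuccAbove, Fin.forall_fin_succ, Fin.insertNthEquiv]
    have hfun : ∀ p : ℝ × (Fin n → ℝ), c + ∑ i, e.symm p i • v i =
        (c + ∑ i, p.2 i • Fin.tail v i) + p.1 • v 0 := by
      intro p
      simp [e, MeasurableEquiv.piFinSuccAbove, Fin.sum_univ_succ, Fin.tail, Fin.insertNthEquiv]
      abel
    have hint : Integrable fun y : Fin (n + 1) → ℝ => (∂^{v} φ) (c + ∑ i, y i • v i) :=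
      integrable_comp_add_sum _ hv c
    have hint' : Integrable fun p : ℝ × (Fin n → ℝ) =>
        (∂^{v} φ) ((c + ∑ i, p.2 i • Fin.tail v i) + p.1 • v 0) := by
      have := (he.integrable_comp_emb e.symm.measurableEmbedding).2 hint
      simpa only [Function.comp_def, hfun] using this
    rw [← he.setIntegral_preimage_emb e.symm.measurableEmbedding, hpre]
    simp only [hfun]
    -- This order of integration puts the first coordinate inside, where the outermost derivative,
    -- along `v 0`, integrates out.
    rw [Measure.volume_eq_prod, ← Measure.prod_restrict, integral_prod_symm]
    · rw [LineDeriv.iteratedLineDerivOp_succ_left, ← hψ]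
      simp only [integral_Ioi_lineDerivOp ψ hv0]
      rw [integral_neg, hψ, ih hv']
      ring
    · rw [Measure.prod_restrict]
      exact hint'.integrableOn

end TestFunctions

/-! ### Products of Heaviside steps as fundamental solutions of the mixed derivative. -/

section Kernels

variable {d : ℕ} {Ω : Opens (Fin d → ℝ)}

theorem sum_smul_stdVec (y : Fin d → ℝ) : ∑ i, y i • stdVec i = y := by
  ext j
  simp [stdVec, Finset.sum_apply, Pi.single_apply]

theorem linearIndependent_stdVec : LinearIndependent ℝ (stdVec (d := d)) := by
  have := (Pi.basisFun ℝ (Fin d)).linearIndependent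
  have h : (stdVec : Fin d → Fin d → ℝ) = Pi.basisFun ℝ (Fin d) := by
    ext1 i
    rw [Pi.basisFun_apply, stdVec]
  rwa [h]

theorem prod_step_eq_indicator (p x : Fin d → ℝ) :
    (∏ i, if p i < x i then (1 : ℝ) else 0) =
      (Set.univ.pi fun i => Set.Ioi (p i)).indicator 1 x := by
  classical
  rw [Finset.prod_ite_zero]
  simp [Set.indicator_apply]

theorem integral_prod_step_mul (φ : 𝓓(Ω, ℝ)) (p : Fin d → ℝ) :
    ∫ x, (∏ i, if p i < x i then (1 : ℝ) else 0) * (∂^{stdVec (d := d)} φ) x =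
      (-1) ^ d * φ p := by
  have h := integral_orthant_iteratedLineDerivOp φ (linearIndependent_stdVec (d := d)) p
  simp only [sum_smul_stdVec] at h
  rw [← h, ← integral_indicator (MeasurableSet.univ_pi fun _ => measurableSet_Ioi),
    ← integral_add_left_eq_self _ p]
  congr 1
  ext x
  rw [prod_step_eq_indicator]
  by_cases hx : x ∈ Set.univ.pi fun _ : Fin d => Set.Ioi (0 : ℝ)
  · rw [Set.indicator_of_mem hx, Set.indicator_of_mem, Pi.one_apply, one_mul]
    simpa using hx
  · rw [Set.indicator_of_notMem hx, Set.indicator_of_notMem, zero_mul]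
    simpa using hx

/-- Expanding the product reduces this to single orthants. Two steps per coordinate suffice for both
uses: the indicator of a box, and a Heaviside kernel shifted by a constant. -/
theorem integral_prod_sum_step_mul (φ : 𝓓(Ω, ℝ)) (c p : Fin d → Bool → ℝ) :
    ∫ x, (∏ i, ∑ b, c i b * if p i b < x i then 1 else 0) * (∂^{stdVec (d := d)} φ) x =
      (-1) ^ d * ∑ σ : Fin d → Bool, (∏ i, c i (σ i)) * φ fun i => p i (σ i) := by
  simp only [Finset.prod_univ_sum, Fintype.piFinset_univ, Finset.prod_mul_distrib,
    Finset.sum_mul, mul_assoc]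
  rw [integral_finsetSum]
  · simp only [integral_const_mul]
    rw [Finset.mul_sum]
    refine Finset.sum_congr rfl fun σ _ => ?_
    rw [integral_prod_step_mul φ fun i => p i (σ i)]
    ring
  · intro σ _
    refine Integrable.const_mul ?_ _
    simp only [prod_step_eq_indicator fun i => p i (σ i)]
    refine (integrable_testFunction (∂^{stdVec (d := d)} φ)).bdd_mul (c := 1) ?_ ?_
    · exact ((measurable_one (α := ℝ)).indicator
        (MeasurableSet.univ_pi fun _ => measurableSet_Ioi)).aestronglyMeasurable
    · refine .of_forall fun x => ?_
      exact (norm_indicator_le_norm_self _ _).trans (by simp)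

end Kernels

/-! ### Essential bounds and Fubini in `L_∞`. -/

section Linfty

variable {d : ℕ} {Ω : Opens (Fin d → ℝ)}

theorem Linfty.ae_norm_le (f : Linfty Ω) :
    ∀ᵐ x ∂volume.restrict (Ω : Set (Fin d → ℝ)), ‖f x‖ ≤ ‖f‖ := by
  have h := enorm_ae_le_eLpNormEssSup f (volume.restrict (Ω : Set (Fin d → ℝ)))
  filter_upwards [h] with x hx
  rw [← eLpNorm_exponent_top, ← Lp.enorm_def] at hx
  exact_mod_cast enorm_le_iff_norm_le.1 hx

theorem Linfty.norm_le_of_ae {f : Linfty Ω} {c : ℝ} (hc : 0 ≤ c)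
    (h : ∀ᵐ x ∂volume.restrict (Ω : Set (Fin d → ℝ)), ‖f x‖ ≤ c) : ‖f‖ ≤ c := by
  rw [Lp.norm_def, eLpNorm_exponent_top]
  exact ENNReal.toReal_le_of_le_ofReal hc (eLpNormEssSup_le_of_ae_bound h)

theorem Linfty.integrable_mul (f : Linfty Ω) {ψ : (Fin d → ℝ) → ℝ} (hψ : Integrable ψ) :
    Integrable (fun x => f x * ψ x) (volume.restrict (Ω : Set (Fin d → ℝ))) :=
  hψ.restrict.bdd_mul (Lp.aestronglyMeasurable f) f.ae_norm_le

/-- Fubini for a bounded function against averages of translates of an integrable function. -/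
theorem integral_mul_integral_translate {P : Type*} [MeasurableSpace P] (ν : Measure P)
    [IsFiniteMeasure ν] {T : P → Fin d → ℝ} (hT : Measurable T) (f : Linfty Ω)
    {ψ : (Fin d → ℝ) → ℝ} (hψc : Continuous ψ) (hψ : Integrable ψ) :
    Integrable (fun p => ∫ x in (Ω : Set (Fin d → ℝ)), f x * ψ (x - T p)) ν ∧
    ∫ x in (Ω : Set (Fin d → ℝ)), f x * ∫ p, ψ (x - T p) ∂ν =
      ∫ p, (∫ x in (Ω : Set (Fin d → ℝ)), f x * ψ (x - T p)) ∂ν := by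
  have hmeas : Measurable fun q : (Fin d → ℝ) × P => ψ (q.1 - T q.2) :=
    hψc.measurable.comp (measurable_fst.sub (hT.comp measurable_snd))
  have h1 : Integrable (fun q : (Fin d → ℝ) × P => ψ (q.1 - T q.2)) (volume.prod ν) := by
    rw [integrable_prod_iff' hmeas.aestronglyMeasurable]
    refine ⟨.of_forall fun p => hψ.comp_sub_right (T p), ?_⟩
    simp only [integral_sub_right_eq_self fun x => ‖ψ x‖]
    exact integrable_const _
  have h2 : Integrable (fun q : (Fin d → ℝ) × P => f q.1 * ψ (q.1 - T q.2))
      ((volume.restrict (Ω : Set (Fin d → ℝ))).prod ν) := by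
    have h3 : Integrable (fun q : (Fin d → ℝ) × P => ψ (q.1 - T q.2))
        ((volume.restrict (Ω : Set (Fin d → ℝ))).prod ν) :=
      h1.mono_measure (Measure.prod_mono Measure.restrict_le_self le_rfl)
    refine h3.bdd_mul (c := ‖f‖) (Lp.aestronglyMeasurable f).comp_fst ?_
    exact Measure.quasiMeasurePreserving_fst.ae f.ae_norm_le
  refine ⟨h2.integral_prod_right, ?_⟩
  simp only [← integral_const_mul]
  exact integral_integral_swap (f := fun x p => f x * ψ (x - T p)) h2

end Linfty

/-! ### The `L_∞` norm by duality with test functions. -/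

section Duality

variable {d : ℕ} {Ω : Opens (Fin d → ℝ)}

/-- `L_∞(Ω)` is normed by the test functions with respect to the norm of `L_1`. -/
theorem Linfty.norm_le_of_integral_mul_le {u : Linfty Ω} {c : ℝ} (hc : 0 ≤ c)
    (h : ∀ φ : 𝓓(Ω, ℝ), |∫ x in (Ω : Set (Fin d → ℝ)), u x * φ x| ≤ c * ∫ x, |φ x|) :
    ‖u‖ ≤ c := by
  refine Linfty.norm_le_of_ae hc ?_
  set v : (Fin d → ℝ) → ℝ := (Ω : Set (Fin d → ℝ)).indicator u with hv
  have hmeas : MeasurableSet (Ω : Set (Fin d → ℝ)) := Ω.isOpen.measurableSet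
  have hloc : LocallyIntegrable v := by
    have h1 : MemLp v ∞ := (memLp_indicator_iff_restrict hmeas).2 (Lp.memLp u)
    exact h1.locallyIntegrable le_top
  -- Mollifiers with outer radius exactly twice the inner one; this bounded ratio gives convergence
  -- almost everywhere.
  let φ : ℕ → ContDiffBump (0 : Fin d → ℝ) := fun n =>
    ⟨1 / ((n : ℝ) + 1), 2 * (1 / ((n : ℝ) + 1)), by positivity,
      by have : 0 < 1 / ((n : ℝ) + 1) := by positivity
         linarith⟩
  have hlim : Filter.Tendsto (fun n => (φ n).rOut) Filter.atTop (nhds 0) := by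
    simpa [φ] using (tendsto_one_div_add_atTop_nhds_zero_nat (𝕜 := ℝ)).const_mul (2 : ℝ)
  have hae := ContDiffBump.ae_convolution_tendsto_right_of_locallyIntegrable (μ := volume)
    (K := 2) hlim (.of_forall fun n => le_rfl) hloc
  filter_upwards [ae_restrict_of_ae hae, ae_restrict_mem hmeas] with x hx hxΩ
  have hvx : v x = u x := Set.indicator_of_mem hxΩ _
  rw [← hvx]
  refine le_of_tendsto hx.norm ?_
  obtain ⟨ε, hε, hball⟩ := Metric.isOpen_iff.1 Ω.isOpen x hxΩ
  filter_upwards [hlim.eventually (gt_mem_nhds hε)] with n hn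
  -- Once the outer radius is below `ε`, the mollifier centred at `x` is supported in `Ω`, and its
  -- `L_1` norm is `1`.
  let ψ : 𝓓(Ω, ℝ) :=
    { toFun := fun y => (φ n).normed volume (x - y)
      contDiff' := (φ n).contDiff_normed.comp (contDiff_const.sub contDiff_id)
      hasCompactSupport' := (φ n).hasCompactSupport_normed.comp_homeomorph (Homeomorph.subLeft x)
      tsupport_subset' := by
        intro y hy
        have h1 : x - y ∈ tsupport ((φ n).normed volume) :=
          tsupport_comp_subset_preimage ((φ n).normed volume) (f := fun y => x - y)
            (by fun_prop) hy
        rw [(φ n).tsupport_normed_eq, mem_closedBall_zero_iff] at h1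
        refine hball ?_
        rw [Metric.mem_ball, dist_comm, dist_eq_norm]
        exact h1.trans_lt hn }
  have hψ1 : ∫ y, |ψ y| = 1 := by
    have : ∀ y, |ψ y| = (φ n).normed volume (x - y) := fun y =>
      abs_of_nonneg ((φ n).nonneg_normed _)
    simp only [this]
    rw [integral_sub_left_eq_self ((φ n).normed volume) volume x, (φ n).integral_normed]
  have hconv : convolution ((φ n).normed volume) v (ContinuousLinearMap.lsmul ℝ ℝ) volume x =
      ∫ y in (Ω : Set (Fin d → ℝ)), u y * ψ y := by
    rw [convolution_eq_swap, ← integral_indicator hmeas]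
    congr 1
    ext y
    by_cases hy : y ∈ (Ω : Set (Fin d → ℝ))
    · rw [hv, Set.indicator_of_mem hy, Set.indicator_of_mem hy, ContinuousLinearMap.lsmul_apply,
        smul_eq_mul, mul_comm]
      rfl
    · rw [hv, Set.indicator_of_notMem hy, Set.indicator_of_notMem hy,
        ContinuousLinearMap.lsmul_apply, smul_zero]
  rw [hconv, Real.norm_eq_abs]
  simpa [hψ1] using h ψ

end Duality

/-! ### The weak Lipschitz estimate from the gradient bound. -/

section Difference

variable {d : ℕ} {Ω : Opens (Fin d → ℝ)}

theorem lineDerivOp_eq_sum (φ : 𝓓(Ω, ℝ)) (y x : Fin d → ℝ) :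
    (∂_{y} φ) x = ∑ i, y i * (∂_{stdVec i} φ) x := by
  simp only [lineDerivOp_eq_fderiv]
  conv_lhs => rw [← sum_smul_stdVec y]
  simp

theorem testFunction_sub_translate (φ : 𝓓(Ω, ℝ)) (x y : Fin d → ℝ) :
    φ x - φ (x - y) = ∫ t in Set.Ioc (0 : ℝ) 1, (∂_{y} φ) (x - t • y) := by
  have hd : ∀ t : ℝ, HasDerivAt (fun t : ℝ => φ (x - t • y)) (-(∂_{y} φ) (x - t • y)) t := by
    intro t
    rw [lineDerivOp_eq_fderiv, ← map_neg]
    have h2 : HasDerivAt (fun t : ℝ => x - t • y) (-y) t := by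
      simpa using ((hasDerivAt_id t).smul_const y).const_sub x
    exact ((differentiable_testFunction φ _).hasFDerivAt).comp_hasDerivAt t h2
  have := intervalIntegral.integral_eq_sub_of_hasDerivAt (a := 0) (b := 1) (fun t _ => hd t)
    (Continuous.intervalIntegrable (by fun_prop) _ _)
  rw [intervalIntegral.integral_neg, intervalIntegral.integral_of_le zero_le_one] at this
  simp only [one_smul, zero_smul, sub_zero] at this
  linarith

/-- An element of `L_∞(Ω)` whose gradient is at most `1` in the `ℓ_1`-norm is weakly Lipschitz
with respect to the sup-norm in the directions that preserve `Ω`. -/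
theorem abs_integral_mul_sub_translate_le {g : Linfty Ω} {G : Fin d → Linfty Ω}
    (hG : ∀ i, IsPartialDeriv Ω i g (G i))
    (hG1 : ∀ᵐ x ∂volume.restrict (Ω : Set (Fin d → ℝ)), ∑ i, |G i x| ≤ 1) (φ : 𝓓(Ω, ℝ))
    {y : Fin d → ℝ} (hy : ∀ t : ℝ, 0 ≤ t → ∀ x ∈ Ω, x + t • y ∈ Ω) :
    |∫ x in (Ω : Set (Fin d → ℝ)), g x * (φ x - φ (x - y))| ≤ ‖y‖ * ∫ x, |φ x| := by
  -- The difference is the integral of `∂_{y} φ` along a segment, so each slice is bounded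
  -- separately. There the derivative moves onto `g`, and `|∑ y_i G_i| ≤ ‖y‖ ∑ |G_i|`.
  have hbound : ∀ t ∈ Set.Ioc (0 : ℝ) 1,
      ‖∫ x in (Ω : Set (Fin d → ℝ)), g x * (∂_{y} φ) (x - t • y)‖ ≤ ‖y‖ * ∫ x, |φ x| := by
    intro t ht
    set φt : 𝓓(Ω, ℝ) := translate φ (t • y) (hy t ht.1.le) with hφt
    have h1 : ∀ i : Fin d, Integrable (fun x => g x * (∂_{stdVec i} φt) x)
        (volume.restrict (Ω : Set (Fin d → ℝ))) := fun i =>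
      g.integrable_mul (integrable_testFunction _)
    have h2 : ∀ i, Integrable (fun x => G i x * φt x)
        (volume.restrict (Ω : Set (Fin d → ℝ))) := fun i =>
      (G i).integrable_mul (integrable_testFunction _)
    have heq : ∫ x in (Ω : Set (Fin d → ℝ)), g x * (∂_{y} φ) (x - t • y) =
        -∫ x in (Ω : Set (Fin d → ℝ)), (∑ i, y i * G i x) * φt x := by
      calc _ = ∫ x in (Ω : Set (Fin d → ℝ)), ∑ i, y i * (g x * (∂_{stdVec i} φt) x) := by
            refine integral_congr_ae (.of_forall fun x => ?_)
            beta_reduce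
            rw [lineDerivOp_eq_sum, Finset.mul_sum]
            refine Finset.sum_congr rfl fun i _ => ?_
            rw [hφt, lineDerivOp_translate, translate_apply]
            ring
        _ = ∑ i, y i * -∫ x in (Ω : Set (Fin d → ℝ)), G i x * φt x := by
            rw [integral_finsetSum _ fun i _ => (h1 i).const_mul _]
            refine Finset.sum_congr rfl fun i _ => ?_
            rw [integral_const_mul, hG i φt]
        _ = _ := by
            simp only [mul_neg, Finset.sum_neg_distrib, neg_inj, Finset.sum_mul, mul_assoc]
            rw [integral_finsetSum _ fun i _ => (h2 i).const_mul _]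
            simp only [integral_const_mul]
    rw [heq, norm_neg]
    calc _ ≤ ∫ x in (Ω : Set (Fin d → ℝ)), ‖y‖ * |φt x| := by
          refine norm_integral_le_of_norm_le
            ((integrable_testFunction φt).abs.const_mul _).restrict ?_
          filter_upwards [hG1] with x hx
          rw [norm_mul, Real.norm_eq_abs, Real.norm_eq_abs]
          refine mul_le_mul_of_nonneg_right ?_ (abs_nonneg _)
          calc |∑ i, y i * G i x| ≤ ∑ i, ‖y‖ * |G i x| := by
                refine (Finset.abs_sum_le_sum_abs _ _).trans (Finset.sum_le_sum fun i _ => ?_)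
                rw [abs_mul]
                exact mul_le_mul_of_nonneg_right (norm_le_pi_norm y i) (abs_nonneg _)
            _ ≤ ‖y‖ := by
                rw [← Finset.mul_sum]
                exact mul_le_of_le_one_right (norm_nonneg _) hx
      _ ≤ ∫ x, ‖y‖ * |φt x| :=
          setIntegral_le_integral ((integrable_testFunction φt).abs.const_mul _)
            (.of_forall fun x => by positivity)
      _ = ‖y‖ * ∫ x, |φ x| := by
          rw [integral_const_mul]
          simp only [hφt, translate_apply]
          rw [integral_sub_right_eq_self fun x => |φ x|]
  have hF := (integral_mul_integral_translate (volume.restrict (Set.Ioc (0 : ℝ) 1))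
    (T := fun t => t • y) (by fun_prop) g (∂_{y} φ).continuous (integrable_testFunction _)).2
  simp only [testFunction_sub_translate]
  rw [hF, ← Real.norm_eq_abs]
  simpa using norm_setIntegral_le_of_norm_le_const (s := Set.Ioc (0 : ℝ) 1)
    (measure_Ioc_lt_top (μ := volume)) hbound

end Difference

/-! ### Translation operators and the pairing with test functions. -/

section Translation

variable {d : ℕ} {Ω : Opens (Fin d → ℝ)}

/-- A shift may map `Ω` onto a proper subset, so the restricted measure need not be preserved;
preserving null sets is enough to act on `L_∞(Ω)`. -/
theorem quasiMeasurePreserving_add_right {y : Fin d → ℝ} (hy : ∀ x ∈ Ω, x + y ∈ Ω) :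
    Measure.QuasiMeasurePreserving (fun x => x + y) (volume.restrict (Ω : Set (Fin d → ℝ)))
      (volume.restrict (Ω : Set (Fin d → ℝ))) := by
  refine ⟨measurable_add_const y, Measure.AbsolutelyContinuous.mk fun s hs h => ?_⟩
  rw [Measure.restrict_apply hs] at h
  rw [Measure.map_apply (measurable_add_const y) hs,
    Measure.restrict_apply (measurable_add_const y hs)]
  have h0 : volume ((fun x => x + y) ⁻¹' (s ∩ Ω)) = 0 := by
    rw [measure_preimage_add_right, h]
  refine measure_mono_null ?_ h0
  exact fun x hx => ⟨hx.1, hy x hx.2⟩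

theorem memLp_comp_add_right {y : Fin d → ℝ} (hy : ∀ x ∈ Ω, x + y ∈ Ω) (f : Linfty Ω) :
    MemLp (fun x => f (x + y)) ∞ (volume.restrict (Ω : Set (Fin d → ℝ))) :=
  memLp_top_of_bound
    ((Lp.aestronglyMeasurable f).comp_quasiMeasurePreserving (quasiMeasurePreserving_add_right hy))
    ‖f‖ ((quasiMeasurePreserving_add_right hy).ae f.ae_norm_le)

/-- The operator `f ↦ f (· + y)` on `L_∞(Ω)`. -/
def translation (y : Fin d → ℝ) (hy : ∀ x ∈ Ω, x + y ∈ Ω) : Linfty Ω →L[ℝ] Linfty Ω :=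
  LinearMap.mkContinuous
    { toFun := fun f => (memLp_comp_add_right hy f).toLp
      map_add' := fun f g => by
        rw [← MemLp.toLp_add]
        exact MemLp.toLp_congr _ _
          ((quasiMeasurePreserving_add_right hy).ae_eq (Lp.coeFn_add f g))
      map_smul' := fun c f => by
        rw [RingHom.id_apply, ← MemLp.toLp_const_smul]
        exact MemLp.toLp_congr _ _
          ((quasiMeasurePreserving_add_right hy).ae_eq (Lp.coeFn_smul c f)) }
    1 fun f => by
      rw [one_mul]
      refine Linfty.norm_le_of_ae (norm_nonneg f) ?_
      filter_upwards [(memLp_comp_add_right hy f).coeFn_toLp,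
        (quasiMeasurePreserving_add_right hy).ae f.ae_norm_le] with x h1 h2
      exact (congrArg norm h1).trans_le h2

theorem norm_translation_le (y : Fin d → ℝ) (hy : ∀ x ∈ Ω, x + y ∈ Ω) :
    ‖translation y hy‖ ≤ 1 :=
  LinearMap.mkContinuous_norm_le _ zero_le_one _

theorem translation_ae_eq (y : Fin d → ℝ) (hy : ∀ x ∈ Ω, x + y ∈ Ω) (f : Linfty Ω) :
    translation y hy f =ᵐ[volume.restrict (Ω : Set (Fin d → ℝ))] fun x => f (x + y) :=
  (memLp_comp_add_right hy f).coeFn_toLp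

/-- The functional `f ↦ ∫ f φ` on `L_∞(Ω)`. -/
def pairing (φ : 𝓓(Ω, ℝ)) : Linfty Ω →ₗ[ℝ] ℝ where
  toFun f := ∫ x in (Ω : Set (Fin d → ℝ)), f x * φ x
  map_add' f g := by
    rw [← integral_add (f.integrable_mul (integrable_testFunction φ))
      (g.integrable_mul (integrable_testFunction φ))]
    refine integral_congr_ae ?_
    filter_upwards [Lp.coeFn_add f g] with x hx
    rw [hx, Pi.add_apply, add_mul]
  map_smul' c f := by
    rw [RingHom.id_apply, smul_eq_mul, ← integral_const_mul]
    refine integral_congr_ae ?_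
    filter_upwards [Lp.coeFn_smul c f] with x hx
    rw [hx, Pi.smul_apply, smul_eq_mul, mul_assoc]

theorem pairing_apply (φ : 𝓓(Ω, ℝ)) (f : Linfty Ω) :
    pairing φ f = ∫ x in (Ω : Set (Fin d → ℝ)), f x * φ x := rfl

theorem pairing_translation (y : Fin d → ℝ) (hy : ∀ x ∈ Ω, x + y ∈ Ω) (φ : 𝓓(Ω, ℝ))
    (f : Linfty Ω) : pairing φ (translation y hy f) = pairing (translate φ y hy) f := by
  have hzero : ∀ (ψ : 𝓓(Ω, ℝ)) (x : Fin d → ℝ), x ∉ (Ω : Set (Fin d → ℝ)) → f x * ψ x = 0 :=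
    fun ψ x hx => by rw [testFunction_eq_zero ψ hx, mul_zero]
  calc pairing φ (translation y hy f)
      = ∫ x in (Ω : Set (Fin d → ℝ)), f (x + y) * φ x := by
        refine integral_congr_ae ?_
        filter_upwards [translation_ae_eq y hy f] with x hx
        rw [hx]
    _ = ∫ x, f (x + y) * φ x :=
        setIntegral_eq_integral_of_forall_compl_eq_zero fun x hx => by
          rw [testFunction_eq_zero φ hx, mul_zero]
    _ = ∫ x, f x * translate φ y hy x := by
        rw [← integral_add_right_eq_self (fun x => f x * translate φ y hy x) y]
        simp
    _ = pairing (translate φ y hy) f :=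
        (setIntegral_eq_integral_of_forall_compl_eq_zero fun x hx => hzero _ x hx).symm

end Translation

/-! ### Mixed differences over boxes and their distance to the mixed derivative. -/

section BoxDifference

variable {d : ℕ} {Ω : Opens (Fin d → ℝ)}

/-- The vertices of the box `∏ [a_i, b_i]`. -/
def vertex (a b : Fin d → ℝ) (σ : Fin d → Bool) : Fin d → ℝ := fun i => if σ i then b i else a i

/-- The sign of a vertex of a box. -/
def vertexSign (σ : Fin d → Bool) : ℝ := ∏ i, if σ i then 1 else -1

theorem vertex_mem_Icc {a b : Fin d → ℝ} (hab : a ≤ b) (σ : Fin d → Bool) :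
    vertex a b σ ∈ Set.Icc a b := by
  constructor <;> intro i <;> simp only [vertex] <;> split_ifs
  exacts [hab i, le_rfl, le_rfl, hab i]

/-- The indicator of a box is a product of differences of two steps. The strict inequality in the
steps, reflected by `z = x - y`, is what makes the intervals closed on the left and open on the
right. -/
theorem sum_vertexSign_mul (φ : 𝓓(Ω, ℝ)) {a b : Fin d → ℝ} (hab : a ≤ b) (x : Fin d → ℝ) :
    ∑ σ, vertexSign σ * φ (x - vertex a b σ) =
      (-1) ^ d * ∫ y in Set.univ.pi fun i => Set.Ico (a i) (b i),
        (∂^{stdVec (d := d)} φ) (x - y) := by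
  have h := integral_prod_sum_step_mul φ (fun _ s => if s then 1 else -1)
    (fun i s => x i - if s then b i else a i)
  have h1 : ∑ σ, vertexSign σ * φ (x - vertex a b σ) =
      ∑ σ : Fin d → Bool, (∏ i, if σ i then (1 : ℝ) else -1) *
        φ (fun i => x i - if σ i then b i else a i) := rfl
  rw [h1]
  have h2 : (-1 : ℝ) ^ d * (-1) ^ d = 1 := by rw [← mul_pow]; simp
  have h3 : ∫ y in Set.univ.pi fun i => Set.Ico (a i) (b i), (∂^{stdVec (d := d)} φ) (x - y) =
      ∫ z, (∏ i, ∑ s : Bool, (if s then (1 : ℝ) else -1) *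
        if (x i - if s then b i else a i) < z i then 1 else 0) *
          (∂^{stdVec (d := d)} φ) z := by
    rw [← integral_sub_left_eq_self _ volume x,
      ← integral_indicator (MeasurableSet.univ_pi fun _ => measurableSet_Ico)]
    congr 1
    ext y
    have : ∀ i, (∑ s : Bool, (if s then (1 : ℝ) else -1) *
        if (x i - if s then b i else a i) < (x - y) i then 1 else 0) =
          if y i ∈ Set.Ico (a i) (b i) then 1 else 0 := by
      intro i
      have := hab i
      rw [Fintype.sum_bool]
      simp only [Pi.sub_apply, sub_lt_sub_iff_left, Set.mem_Ico]
      by_cases h1 : y i < b i <;> by_cases h2 : y i < a i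
      · simp [h1, h2]
      · simp [h1, h2, not_lt.1 h2]
      · exact absurd (h2.trans_le this) h1
      · simp [h1, h2]
    simp only [this]
    rw [Finset.prod_ite_zero]
    by_cases hy : y ∈ Set.univ.pi fun i => Set.Ico (a i) (b i)
    · rw [Set.indicator_of_mem hy, if_pos fun i _ => hy i trivial]
      simp
    · rw [Set.indicator_of_notMem hy, if_neg fun h => hy fun i _ => h i (Finset.mem_univ i),
        zero_mul]
  rw [h3, h, ← mul_assoc, h2, one_mul]

/-- The operator that takes the mixed difference over the box `∏ [a_i, b_i]`. -/
def boxDifference {a b : Fin d → ℝ} (hab : a ≤ b) (hΩ : ∀ y ∈ Set.Icc a b, ∀ x ∈ Ω, x + y ∈ Ω) :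
    Linfty Ω →L[ℝ] Linfty Ω :=
  ∑ σ, vertexSign σ • translation (vertex a b σ) (hΩ _ (vertex_mem_Icc hab σ))

theorem norm_boxDifference_le {a b : Fin d → ℝ} (hab : a ≤ b)
    (hΩ : ∀ y ∈ Set.Icc a b, ∀ x ∈ Ω, x + y ∈ Ω) : ‖boxDifference hab hΩ‖ ≤ 2 ^ d := by
  refine (norm_sum_le _ _).trans ?_
  calc _ ≤ ∑ _σ : Fin d → Bool, (1 : ℝ) := by
        refine Finset.sum_le_sum fun σ _ => ?_
        rw [norm_smul]
        have : ‖vertexSign σ‖ = 1 := by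
          rw [vertexSign, norm_prod]
          refine Finset.prod_eq_one fun i _ => ?_
          split_ifs <;> simp
        rw [this, one_mul]
        exact norm_translation_le _ _
    _ = 2 ^ d := by simp

/-- The weak form of the fact that a mixed difference of `f` integrates the translates of `g` over
the box. -/
theorem pairing_boxDifference {a b : Fin d → ℝ} (hab : a ≤ b)
    (hΩ : ∀ y ∈ Set.Icc a b, ∀ x ∈ Ω, x + y ∈ Ω) {f g : Linfty Ω} (hfg : IsMixedDeriv Ω f g)
    (φ : 𝓓(Ω, ℝ)) :
    pairing φ (boxDifference hab hΩ f) =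
      ∫ y in Set.univ.pi fun i => Set.Ico (a i) (b i),
        ∫ x in (Ω : Set (Fin d → ℝ)), g x * φ (x - y) := by
  have hmeas : MeasurableSet (Set.univ.pi fun i => Set.Ico (a i) (b i)) :=
    MeasurableSet.univ_pi fun _ => measurableSet_Ico
  have hfin : volume (Set.univ.pi fun i => Set.Ico (a i) (b i)) ≠ ∞ := by
    rw [Real.volume_pi_Ico]
    exact ENNReal.prod_ne_top fun i _ => ENNReal.ofReal_ne_top
  have : IsFiniteMeasure (volume.restrict (Set.univ.pi fun i => Set.Ico (a i) (b i))) :=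
    isFiniteMeasure_restrict.2 hfin
  have hsq : (-1 : ℝ) ^ d * (-1) ^ d = 1 := by rw [← mul_pow]; simp
  calc pairing φ (boxDifference hab hΩ f)
      = ∑ σ, vertexSign σ *
          ∫ x in (Ω : Set (Fin d → ℝ)), f x * φ (x - vertex a b σ) := by
        simp only [boxDifference, sum_apply, map_sum,
          smul_apply, map_smul, pairing_translation, smul_eq_mul]
        rfl
    _ = ∫ x in (Ω : Set (Fin d → ℝ)), f x * ∑ σ, vertexSign σ * φ (x - vertex a b σ) := by
        simp only [Finset.mul_sum, ← integral_const_mul]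
        rw [integral_finsetSum]
        · refine Finset.sum_congr rfl fun σ _ => integral_congr_ae (.of_forall fun x => ?_)
          ring
        · intro σ _
          exact f.integrable_mul (((integrable_testFunction φ).comp_sub_right _).const_mul _)
    _ = (-1) ^ d * ∫ x in (Ω : Set (Fin d → ℝ)), f x *
          ∫ y in Set.univ.pi fun i => Set.Ico (a i) (b i),
            (∂^{stdVec (d := d)} φ) (x - y) := by
        rw [← integral_const_mul]
        refine integral_congr_ae (.of_forall fun x => ?_)
        beta_reduce
        rw [sum_vertexSign_mul φ hab]
        ring
    _ = (-1) ^ d * ∫ y in Set.univ.pi fun i => Set.Ico (a i) (b i),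
          (-1) ^ d * ∫ x in (Ω : Set (Fin d → ℝ)), g x * φ (x - y) := by
        rw [(integral_mul_integral_translate (T := fun y => y) _ measurable_id f
          (∂^{stdVec (d := d)} φ).continuous (integrable_testFunction _)).2]
        congr 1
        refine setIntegral_congr_fun hmeas fun y hy => ?_
        -- The shift keeps `Ω` inside itself, so the translated test function may be inserted in the
        -- definition of `g`.
        have hy' : ∀ x ∈ Ω, x + y ∈ Ω :=
          hΩ y ⟨fun i => (hy i trivial).1, fun i => (hy i trivial).2.le⟩
        have := hfg (translate φ y hy')
        rwa [iteratedLineDerivOp_translate] at this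
    _ = _ := by rw [integral_const_mul, ← mul_assoc, hsq, one_mul]

/-- The mixed derivative is approximated by the mean mixed difference over a box. -/
theorem norm_sub_boxDifference_le {a b : Fin d → ℝ} (hab : a ≤ b)
    (hΩ : ∀ y ∈ Set.Icc a b, ∀ x ∈ Ω, x + y ∈ Ω)
    (hΩ' : ∀ y ∈ Set.Icc a b, ∀ t : ℝ, 0 ≤ t → ∀ x ∈ Ω, x + t • y ∈ Ω)
    {f g : Linfty Ω} (hfg : IsMixedDeriv Ω f g) {G : Fin d → Linfty Ω}
    (hG : ∀ i, IsPartialDeriv Ω i g (G i))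
    (hG1 : ∀ᵐ x ∂volume.restrict (Ω : Set (Fin d → ℝ)), ∑ i, |G i x| ≤ 1)
    {V : ℝ} (hV : 0 < V) (hVab : ∏ i, (b i - a i) = V) :
    ‖g - V⁻¹ • boxDifference hab hΩ f‖ ≤
      V⁻¹ * ∫ y in Set.univ.pi fun i => Set.Ico (a i) (b i), ‖y‖ := by
  have hmeas : MeasurableSet (Set.univ.pi fun i => Set.Ico (a i) (b i)) :=
    MeasurableSet.univ_pi fun _ => measurableSet_Ico
  have hvol : volume.real (Set.univ.pi fun i => Set.Ico (a i) (b i)) = V := by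
    rw [measureReal_def, Real.volume_pi_Ico_toReal hab, hVab]
  have hfin : volume (Set.univ.pi fun i => Set.Ico (a i) (b i)) ≠ ∞ := by
    rw [Real.volume_pi_Ico]
    exact ENNReal.prod_ne_top fun i _ => ENNReal.ofReal_ne_top
  have : IsFiniteMeasure (volume.restrict (Set.univ.pi fun i => Set.Ico (a i) (b i))) :=
    isFiniteMeasure_restrict.2 hfin
  have hsub : (Set.univ.pi fun i => Set.Ico (a i) (b i)) ⊆ Set.Icc a b := fun y hy =>
    ⟨fun i => (hy i trivial).1, fun i => (hy i trivial).2.le⟩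
  have hnorm : IntegrableOn (fun y : Fin d → ℝ => ‖y‖)
      (Set.univ.pi fun i => Set.Ico (a i) (b i)) :=
    (continuous_norm.continuousOn.integrableOn_compact isCompact_Icc).mono_set hsub
  refine Linfty.norm_le_of_integral_mul_le
    (mul_nonneg (inv_nonneg.2 hV.le) (integral_nonneg fun _ => norm_nonneg _)) fun φ => ?_
  have hint := (integral_mul_integral_translate (T := fun y => y)
    (volume.restrict (Set.univ.pi fun i => Set.Ico (a i) (b i))) measurable_id g
    φ.continuous (integrable_testFunction φ)).1
  have key : pairing φ (g - V⁻¹ • boxDifference hab hΩ f) =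
      V⁻¹ * ∫ y in Set.univ.pi fun i => Set.Ico (a i) (b i),
        ∫ x in (Ω : Set (Fin d → ℝ)), g x * (φ x - φ (x - y)) := by
    rw [map_sub, map_smul, pairing_boxDifference hab hΩ hfg, smul_eq_mul]
    have h1 : ∀ y, ∫ x in (Ω : Set (Fin d → ℝ)), g x * (φ x - φ (x - y)) =
        pairing φ g - ∫ x in (Ω : Set (Fin d → ℝ)), g x * φ (x - y) := by
      intro y
      rw [pairing_apply, ← integral_sub (g.integrable_mul (integrable_testFunction φ))
        (g.integrable_mul ((integrable_testFunction φ).comp_sub_right y))]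
      simp only [mul_sub]
    simp only [h1]
    rw [integral_sub (integrable_const _) hint, setIntegral_const, hvol, smul_eq_mul]
    field_simp
  rw [← pairing_apply, key, abs_mul, abs_of_pos (inv_pos.2 hV), mul_assoc, ← integral_mul_const]
  refine mul_le_mul_of_nonneg_left ?_ (inv_nonneg.2 hV.le)
  rw [← Real.norm_eq_abs]
  refine norm_integral_le_of_norm_le (hnorm.mul_const _) ?_
  filter_upwards [ae_restrict_mem hmeas] with y hy
  exact abs_integral_mul_sub_translate_le hG hG1 φ (hΩ' y (hsub hy))

end BoxDifference

/-! ### Integrals of the tent function over orthants and products of lines and half-lines. -/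

section Tent

variable {d : ℕ}

/-- The tent function of height `h` for the sup-norm. -/
def tent (d : ℕ) (h : ℝ) (y : Fin d → ℝ) : ℝ := max (h - ‖y‖) 0

theorem continuous_tent (h : ℝ) : Continuous (tent d h) := by
  unfold tent
  fun_prop

theorem tent_nonneg (h : ℝ) (y : Fin d → ℝ) : 0 ≤ tent d h y := le_max_right _ _

theorem tent_eq_zero {h : ℝ} {y : Fin d → ℝ} (hy : h ≤ ‖y‖) : tent d h y = 0 :=
  max_eq_right (by linarith)

theorem tent_le {h : ℝ} (hh : 0 ≤ h) (y : Fin d → ℝ) : tent d h y ≤ h :=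
  max_le (by linarith [norm_nonneg y]) hh

theorem integrable_tent (h : ℝ) : Integrable (tent d h) := by
  refine (continuous_tent h).integrable_of_hasCompactSupport ?_
  refine HasCompactSupport.of_support_subset_isCompact (isCompact_closedBall 0 h) fun y hy => ?_
  rw [mem_closedBall_zero_iff]
  by_contra hlt
  exact hy (tent_eq_zero (not_le.1 hlt).le)

/-- Layer-cake formula: the set where the tent exceeds `t > 0` is the sup-norm ball of radius `h -
t`. -/
theorem setIntegral_tent {O : Set (Fin d → ℝ)} {c : ℝ}
    (hc : ∀ s : ℝ, 0 < s → volume.real (O ∩ Metric.ball 0 s) = c * s ^ d) {h : ℝ} (hh : 0 < h) :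
    ∫ y in O, tent d h y = c * (h ^ (d + 1) / (d + 1)) := by
  rw [(integrable_tent h).restrict.integral_eq_integral_meas_lt (.of_forall (tent_nonneg h))]
  have h1 : ∀ t ∈ Set.Ioi (0 : ℝ), (volume.restrict O).real {y | t < tent d h y} =
      (Set.Ioo 0 h).indicator (fun t => c * (h - t) ^ d) t := by
    intro t ht
    have ht' : 0 < t := ht
    have hset : {y | t < tent d h y} = Metric.ball 0 (h - t) := by
      ext y
      simp only [Set.mem_ofPred_eq, tent, lt_max_iff, mem_ball_zero_iff, ht'.not_gt, or_false]
      constructor <;> intro <;> linarith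
    rw [hset, measureReal_restrict_apply measurableSet_ball, Set.inter_comm]
    by_cases hth : t < h
    · rw [hc _ (sub_pos.2 hth), Set.indicator_of_mem (Set.mem_Ioo.2 ⟨ht', hth⟩)]
    · rw [Metric.ball_eq_empty.2 (by linarith), Set.inter_empty, measureReal_empty,
        Set.indicator_of_notMem fun h => hth h.2]
  rw [setIntegral_congr_fun measurableSet_Ioi h1, setIntegral_indicator measurableSet_Ioo,
    Set.inter_eq_right.2 Set.Ioo_subset_Ioi_self, ← integral_Ioc_eq_integral_Ioo,
    ← intervalIntegral.integral_of_le hh.le, intervalIntegral.integral_const_mul]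
  congr 1
  rw [intervalIntegral.integral_comp_sub_left (fun t => t ^ d) h]
  simp

theorem setIntegral_pi_tent {I : Fin d → Set ℝ} {κ : Fin d → ℝ}
    (hκ : ∀ i, ∀ s : ℝ, 0 < s → volume.real (I i ∩ Set.Ioo (-s) s) = κ i * s)
    {h : ℝ} (hh : 0 < h) :
    ∫ y in Set.univ.pi I, tent d h y = (∏ i, κ i) * (h ^ (d + 1) / (d + 1)) := by
  refine setIntegral_tent (fun s hs => ?_) hh
  rw [ball_pi _ hs, ← Set.pi_inter_distrib, measureReal_def, volume_pi_pi, ENNReal.toReal_prod]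
  simp only [Pi.zero_apply, Real.ball_eq_Ioo, zero_sub, zero_add]
  calc _ = ∏ i, κ i * s := Finset.prod_congr rfl fun i _ => hκ i s hs
    _ = _ := by simp [Finset.prod_mul_distrib]

theorem volume_Ici_inter_Ioo (s : ℝ) (hs : 0 < s) :
    volume.real (Set.Ici 0 ∩ Set.Ioo (-s) s) = 1 * s := by
  have : Set.Ici 0 ∩ Set.Ioo (-s) s = Set.Ico 0 s := by
    ext x
    simp only [Set.mem_inter_iff, Set.mem_Ici, Set.mem_Ioo, Set.mem_Ico]
    constructor
    · exact fun h => ⟨h.1, h.2.2⟩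
    · exact fun h => ⟨h.1, by linarith [h.1], h.2⟩
  rw [this, Real.volume_real_Ico_of_le hs.le]
  ring

theorem volume_Iic_inter_Ioo (s : ℝ) (hs : 0 < s) :
    volume.real (Set.Iic 0 ∩ Set.Ioo (-s) s) = 1 * s := by
  have : Set.Iic 0 ∩ Set.Ioo (-s) s = Set.Ioc (-s) 0 := by
    ext x
    simp only [Set.mem_inter_iff, Set.mem_Iic, Set.mem_Ioo, Set.mem_Ioc]
    constructor
    · exact fun h => ⟨h.2.1, h.1⟩
    · exact fun h => ⟨h.2, h.1, by linarith [h.2]⟩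
  rw [this, Real.volume_real_Ioc_of_le (by linarith)]
  ring

end Tent

/-! ### The approximating operator on the cone. -/

section UpperBound

variable {d m : ℕ}

theorem add_smul_mem_cone {x y : Fin d → ℝ} (hx : x ∈ cone d m)
    (hy : ∀ i : Fin d, (i : ℕ) < m → 0 ≤ y i) {t : ℝ} (ht : 0 ≤ t) : x + t • y ∈ cone d m :=
  fun i hi => add_pos_of_pos_of_nonneg (hx i hi) (mul_nonneg ht (hy i hi))

/-- On the box `‖y‖ = h - tent d h y`, and the tent vanishes on the rest of the product of
half-lines and lines. With `V` the volume of the box, the integral is therefore `h V - V h / (d+1)`.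
-/
theorem setIntegral_norm_box {h : ℝ} (hh : 0 < h) {a b : Fin d → ℝ}
    (ha : ∀ i : Fin d, a i = if (i : ℕ) < m then 0 else -h) (hb : ∀ i, b i = h) :
    ∫ y in Set.univ.pi fun i => Set.Ico (a i) (b i), ‖y‖ =
      (∏ i, (b i - a i)) * (d / (d + 1) * h) := by
  set κ : Fin d → ℝ := fun i => if (i : ℕ) < m then 1 else 2 with hκ
  set I : Fin d → Set ℝ := fun i => if (i : ℕ) < m then Set.Ici 0 else Set.univ with hI
  have hab : a ≤ b := fun i => by rw [ha, hb]; split_ifs <;> linarith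
  have hV : ∏ i, (b i - a i) = (∏ i, κ i) * h ^ d := by
    have : ∀ i, b i - a i = κ i * h := fun i => by
      rw [ha, hb, hκ]; dsimp only; split_ifs <;> ring
    simp [this, Finset.prod_mul_distrib]
  have hImeas : ∀ i, MeasurableSet (I i) := fun i => by
    simp only [hI]; split_ifs
    exacts [measurableSet_Ici, MeasurableSet.univ]
  have hmeas : MeasurableSet (Set.univ.pi fun i => Set.Ico (a i) (b i)) :=
    MeasurableSet.univ_pi fun _ => measurableSet_Ico
  have htent := setIntegral_pi_tent (I := I) (κ := κ) (fun i s hs => by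
    simp only [hI, hκ]
    split_ifs
    · exact volume_Ici_inter_Ioo s hs
    · rw [Set.univ_inter, Real.volume_real_Ioo_of_le (by linarith)]
      ring) hh
  have hsub : (Set.univ.pi fun i => Set.Ico (a i) (b i)) ⊆ Set.univ.pi I := by
    intro y hy i _
    have := (hy i trivial).1
    rw [ha] at this
    simp only [hI]
    split_ifs with hi
    · simpa [hi] using this
    · trivial
  rw [setIntegral_eq_of_subset_of_forall_sdiff_eq_zero (MeasurableSet.univ_pi hImeas) hsub
    ?_] at htent
  · have hfin : volume.real (Set.univ.pi fun i => Set.Ico (a i) (b i)) = ∏ i, (b i - a i) := by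
      rw [measureReal_def, Real.volume_pi_Ico_toReal hab]
    have hcongr : ∫ y in Set.univ.pi fun i => Set.Ico (a i) (b i), ‖y‖ =
        ∫ y in Set.univ.pi fun i => Set.Ico (a i) (b i), (h - tent d h y) := by
      refine setIntegral_congr_fun hmeas fun y hy => ?_
      have hle : ‖y‖ ≤ h := by
        rw [pi_norm_le_iff_of_nonneg hh.le]
        intro i
        have h1 := hy i trivial
        rw [Set.mem_Ico, ha, hb] at h1
        rw [Real.norm_eq_abs, abs_le]
        refine ⟨?_, h1.2.le⟩
        split_ifs at h1 <;> linarith [h1.1]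
      simp only [tent]
      rw [max_eq_left (by linarith)]
      ring
    have hconst : IntegrableOn (fun _ : Fin d → ℝ => h)
        (Set.univ.pi fun i => Set.Ico (a i) (b i)) := by
      refine integrableOn_const ?_
      rw [Real.volume_pi_Ico]
      exact ENNReal.prod_ne_top fun i _ => ENNReal.ofReal_ne_top
    rw [hcongr, integral_sub hconst (integrable_tent h).integrableOn, htent, setIntegral_const,
      hfin, hV, smul_eq_mul]
    have : (d : ℝ) + 1 ≠ 0 := by positivity
    field_simp
    ring
  · intro y hy
    obtain ⟨hyI, hyQ⟩ := hy
    simp only [Set.mem_univ_pi, not_forall] at hyQ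
    obtain ⟨i, hi⟩ := hyQ
    refine tent_eq_zero (le_trans ?_ (norm_le_pi_norm y i))
    rw [Real.norm_eq_abs, le_abs]
    by_contra hcon
    push Not at hcon
    refine hi ?_
    rw [Set.mem_Ico, ha, hb]
    refine ⟨?_, hcon.1⟩
    have h2 := hyI i trivial
    simp only [hI] at h2
    split_ifs with hm
    · simpa [hm] using h2
    · linarith [hcon.2]

theorem prod_ite_lt_one_two (hm : m ≤ d) :
    (∏ i : Fin d, if (i : ℕ) < m then (1 : ℝ) else 2) = 2 ^ d / 2 ^ m := by
  have h1 : (∏ i : Fin d, if (i : ℕ) < m then (2 : ℝ) else 1) = 2 ^ m := by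
    rw [Finset.prod_ite, Finset.prod_const, Finset.prod_const_one, mul_one,
      Fin.card_filter_val_lt, min_eq_right hm]
  have h2 : (∏ i : Fin d, if (i : ℕ) < m then (1 : ℝ) else 2) *
      (∏ i : Fin d, if (i : ℕ) < m then (2 : ℝ) else 1) = 2 ^ d := by
    rw [← Finset.prod_mul_distrib]
    have : ∀ i : Fin d, (if (i : ℕ) < m then (1 : ℝ) else 2) *
        (if (i : ℕ) < m then (2 : ℝ) else 1) = 2 := fun i => by split_ifs <;> norm_num
    simp [this]
  rw [h1] at h2
  field_simp
  exact h2

theorem exists_approx_mixedDeriv (hm : m ≤ d) {h : ℝ} (hh : 0 < h) :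
    ∃ S : Linfty (cone d m) →L[ℝ] Linfty (cone d m), ‖S‖ ≤ 2 ^ m / h ^ d ∧
      ∀ f ∈ mixedClass (cone d m), ‖mixedDeriv (cone d m) f - S f‖ ≤ d / (d + 1) * h := by
  -- In the first `m` coordinates only nonnegative shifts preserve the cone, so the box is one-sided
  -- there; this halves its volume once for each such coordinate.
  set a : Fin d → ℝ := fun i => if (i : ℕ) < m then 0 else -h with ha
  set b : Fin d → ℝ := fun _ => h with hb
  have hab : a ≤ b := fun i => by simp only [ha, hb]; split_ifs <;> linarith
  have hΩ' : ∀ y ∈ Set.Icc a b, ∀ t : ℝ, 0 ≤ t → ∀ x ∈ cone d m, x + t • y ∈ cone d m := by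
    intro y hy t ht x hx
    refine add_smul_mem_cone hx (fun i hi => ?_) ht
    simpa [ha, hi] using hy.1 i
  have hΩ : ∀ y ∈ Set.Icc a b, ∀ x ∈ cone d m, x + y ∈ cone d m := fun y hy x hx => by
    simpa using hΩ' y hy 1 zero_le_one x hx
  have hV : ∏ i, (b i - a i) = 2 ^ d / 2 ^ m * h ^ d := by
    have : ∀ i : Fin d, b i - a i = (if (i : ℕ) < m then 1 else 2) * h := fun i => by
      simp only [ha, hb]; split_ifs <;> ring
    simp only [this, Finset.prod_mul_distrib, prod_ite_lt_one_two hm]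
    simp
  set V : ℝ := 2 ^ d / 2 ^ m * h ^ d with hVdef
  have hV0 : 0 < V := by positivity
  refine ⟨V⁻¹ • boxDifference hab hΩ, ?_, fun f hf => ?_⟩
  · rw [norm_smul, Real.norm_of_nonneg (inv_nonneg.2 hV0.le)]
    calc _ ≤ V⁻¹ * 2 ^ d :=
          mul_le_mul_of_nonneg_left (norm_boxDifference_le hab hΩ) (inv_nonneg.2 hV0.le)
      _ = _ := by rw [hVdef]; field_simp
  · obtain ⟨⟨g, hg, hfg⟩, hgrad⟩ := hf
    rw [hfg.mixedDeriv_eq] at hgrad ⊢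
    have hG1 : ∀ᵐ x ∂volume.restrict (cone d m : Set (Fin d → ℝ)),
        ∑ i, |partialDeriv (cone d m) i g x| ≤ 1 := by
      have h1 := enorm_ae_le_eLpNormEssSup
        (fun x => ∑ i, |partialDeriv (cone d m) i g x|)
        (volume.restrict (cone d m : Set (Fin d → ℝ)))
      filter_upwards [h1] with x hx
      have h2 : ‖∑ i, |partialDeriv (cone d m) i g x|‖ₑ ≤ 1 := hx.trans hgrad
      have h3 : ‖∑ i, |partialDeriv (cone d m) i g x|‖ ≤ 1 := by
        rw [← ofReal_norm] at h2
        exact ENNReal.ofReal_le_one.1 h2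
      exact (le_abs_self _).trans h3
    have := norm_sub_boxDifference_le hab hΩ hΩ' hfg
      (fun i => by
        obtain ⟨G, hG⟩ := hg i
        rwa [hG.partialDeriv_eq]) hG1 hV0 hV
    rw [setIntegral_norm_box hh (m := m) (fun i => rfl) (fun i => rfl), hV,
      inv_mul_cancel_left₀ hV0.ne'] at this
    exact this

end UpperBound

/-! ### The tent function in the Sobolev space: gradient and norm. -/

section TentClass

variable {d m : ℕ}

theorem lipschitzWith_tent (h : ℝ) : LipschitzWith 1 (tent d h) := by
  refine LipschitzWith.of_dist_le_mul fun x y => ?_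
  rw [NNReal.coe_one, one_mul, Real.dist_eq, dist_eq_norm]
  calc |tent d h x - tent d h y| ≤ |(h - ‖x‖) - (h - ‖y‖)| := abs_max_sub_max_le_abs _ _ _
    _ = |‖y‖ - ‖x‖| := by congr 1; ring
    _ ≤ ‖x - y‖ := by rw [norm_sub_rev]; exact abs_norm_sub_norm_le y x

theorem memLp_tent {h : ℝ} (hh : 0 ≤ h) (μ : Measure (Fin d → ℝ)) : MemLp (tent d h) ∞ μ :=
  memLp_top_of_bound (continuous_tent h).aestronglyMeasurable h
    (.of_forall fun y => by
      rw [Real.norm_of_nonneg (tent_nonneg h y)]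
      exact tent_le hh y)

/-- The restriction of the tent function to `Ω` as an element of `L_∞(Ω)`. -/
def tentLp (Ω : Opens (Fin d → ℝ)) {h : ℝ} (hh : 0 ≤ h) : Linfty Ω := (memLp_tent hh _).toLp

theorem tentLp_ae_eq (Ω : Opens (Fin d → ℝ)) {h : ℝ} (hh : 0 ≤ h) :
    tentLp Ω hh =ᵐ[volume.restrict (Ω : Set (Fin d → ℝ))] tent d h := MemLp.coeFn_toLp _

/-- Integration by parts for Lipschitz functions: the almost everywhere derivative is also the
distributional one. -/
theorem isPartialDeriv_tentLp (Ω : Opens (Fin d → ℝ)) {h : ℝ} (hh : 0 ≤ h) (i : Fin d) :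
    IsPartialDeriv Ω i (tentLp Ω hh)
      (((lipschitzWith_tent h).memLp_lineDeriv (stdVec i)).toLp) := by
  intro φ
  obtain ⟨D, hD⟩ := φ.contDiff.lipschitzWith_of_hasCompactSupport φ.hasCompactSupport (by simp)
  have hkey := (lipschitzWith_tent (d := d) h).integral_lineDeriv_mul_eq (μ := volume) hD
    φ.hasCompactSupport (stdVec i)
  have hlin : ∀ x, lineDeriv ℝ φ x (-stdVec i) = -(∂_{stdVec i} φ) x := fun x => by
    rw [(differentiable_testFunction φ x).lineDeriv_eq_fderiv, lineDerivOp_eq_fderiv, map_neg]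
  calc ∫ x in (Ω : Set (Fin d → ℝ)), tentLp Ω hh x * (∂_{stdVec i} φ) x
      = ∫ x in (Ω : Set (Fin d → ℝ)), tent d h x * (∂_{stdVec i} φ) x := by
        refine integral_congr_ae ?_
        filter_upwards [tentLp_ae_eq Ω hh] with x hx
        rw [hx]
    _ = ∫ x, tent d h x * (∂_{stdVec i} φ) x :=
        setIntegral_eq_integral_of_forall_compl_eq_zero fun x hx => by
          rw [testFunction_eq_zero _ hx, mul_zero]
    _ = -∫ x, lineDeriv ℝ (tent d h) x (stdVec i) * φ x := by
        rw [hkey, ← integral_neg]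
        refine integral_congr_ae (.of_forall fun x => ?_)
        beta_reduce
        rw [hlin]
        ring
    _ = -∫ x in (Ω : Set (Fin d → ℝ)), lineDeriv ℝ (tent d h) x (stdVec i) * φ x := by
        rw [setIntegral_eq_integral_of_forall_compl_eq_zero fun x hx => by
          rw [testFunction_eq_zero _ hx, mul_zero]]
    _ = _ := by
        congr 1
        refine integral_congr_ae ?_
        filter_upwards [((lipschitzWith_tent h).memLp_lineDeriv
          (μ := volume.restrict (Ω : Set (Fin d → ℝ))) (stdVec i)).coeFn_toLp] with x hx
        rw [hx]

/-- The dual of the sup-norm is the `ℓ_1`-norm; the vector of signs of the coefficients is the test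
vector. -/
theorem sum_abs_apply_stdVec_le (L : (Fin d → ℝ) →L[ℝ] ℝ) : ∑ i, |L (stdVec i)| ≤ ‖L‖ := by
  set s : Fin d → ℝ := fun i => SignType.sign (L (stdVec i)) with hs
  have hnorm : ‖s‖ ≤ 1 := by
    rw [pi_norm_le_iff_of_nonneg zero_le_one]
    intro i
    simp only [hs]
    cases SignType.sign (L (stdVec i)) <;> simp
  have heq : ∑ i, |L (stdVec i)| = L s := by
    conv_rhs => rw [← sum_smul_stdVec s]
    simp [hs, sign_mul_self]
  rw [heq]
  calc L s ≤ ‖L s‖ := le_abs_self _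
    _ ≤ ‖L‖ * ‖s‖ := L.le_opNorm s
    _ ≤ ‖L‖ := mul_le_of_le_one_right (norm_nonneg _) hnorm

theorem gradNorm_tentLp_le (Ω : Opens (Fin d → ℝ)) {h : ℝ} (hh : 0 ≤ h) :
    gradNorm Ω (tentLp Ω hh) ≤ 1 := by
  rw [gradNorm, eLpNorm_exponent_top, ← ENNReal.ofReal_one]
  refine eLpNormEssSup_le_of_ae_bound ?_
  have h1 : ∀ i : Fin d, ∀ᵐ x ∂volume.restrict (Ω : Set (Fin d → ℝ)),
      partialDeriv Ω i (tentLp Ω hh) x = lineDeriv ℝ (tent d h) x (stdVec i) := fun i => by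
    rw [(isPartialDeriv_tentLp Ω hh i).partialDeriv_eq]
    exact MemLp.coeFn_toLp _
  filter_upwards [ae_all_iff.2 h1,
    ae_restrict_of_ae (lipschitzWith_tent (d := d) h).ae_differentiableAt] with x hx hdiff
  simp only [hx, hdiff.lineDeriv_eq_fderiv]
  rw [Real.norm_of_nonneg (Finset.sum_nonneg fun i _ => abs_nonneg _)]
  refine (sum_abs_apply_stdVec_le _).trans ?_
  exact_mod_cast norm_fderiv_le_of_lipschitz ℝ (lipschitzWith_tent h)

theorem le_norm_tentLp {h : ℝ} (hh : 0 ≤ h) : h ≤ ‖tentLp (cone d m) hh‖ := by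
  by_contra! hlt
  set c := ‖tentLp (cone d m) hh‖ with hc
  have hae : ∀ᵐ x ∂volume.restrict (cone d m : Set (Fin d → ℝ)), tent d h x ≤ c := by
    filter_upwards [tentLp_ae_eq (cone d m) hh, (tentLp (cone d m) hh).ae_norm_le] with x h1 h2
    rw [← h1]
    exact (le_abs_self _).trans h2
  have hopen : IsOpen ((cone d m : Set (Fin d → ℝ)) ∩ {x | c < tent d h x}) :=
    (cone d m).isOpen.inter (isOpen_lt continuous_const (continuous_tent h))
  have hne : ((cone d m : Set (Fin d → ℝ)) ∩ {x | c < tent d h x}).Nonempty := by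
    -- The apex `0` may lie on the boundary of the cone. This nearby interior point has tent value
    -- at least `(h + c) / 2 > c`.
    refine ⟨fun _ => (h - c) / 2, fun i _ => ?_, ?_⟩
    · dsimp only
      linarith
    · have hn : ‖fun _ : Fin d => (h - c) / 2‖ ≤ (h - c) / 2 := by
        rw [pi_norm_le_iff_of_nonneg (by linarith)]
        exact fun _ => (Real.norm_of_nonneg (by linarith)).le
      change c < max (h - ‖fun _ : Fin d => (h - c) / 2‖) 0
      exact lt_max_of_lt_left (by linarith)
  have hpos := hopen.measure_pos volume hne
  rw [ae_restrict_iff' (cone d m).isOpen.measurableSet] at hae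
  refine hpos.ne' (measure_mono_null ?_ hae)
  intro x hx hcon
  exact (hcon hx.1).not_gt hx.2

end TentClass

/-! ### The extremal function: a primitive of the tent with small norm. -/

section Primitive

variable {d m : ℕ}

/-- The shift of the one-dimensional Heaviside kernel. -/
def kernelShift (m i : ℕ) (t : ℝ) : ℝ := if i < m then 1 / 2 else if t < 0 then 1 else 0

/-- The kernel of a right inverse of the mixed derivative on the cone. -/
def primitiveKernel (m : ℕ) (x y : Fin d → ℝ) : ℝ :=
  ∏ i : Fin d, ((if y i < x i then 1 else 0) - kernelShift m i (y i))

/-- The primitive of the tent function with respect to the mixed derivative on the cone. -/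
def tentPrimitive (m : ℕ) (h : ℝ) (x : Fin d → ℝ) : ℝ :=
  ∫ y in (cone d m : Set (Fin d → ℝ)), primitiveKernel m x y * tent d h y

theorem measurable_primitiveKernel :
    Measurable fun p : (Fin d → ℝ) × (Fin d → ℝ) => primitiveKernel m p.1 p.2 := by
  unfold primitiveKernel kernelShift
  refine Finset.measurable_prod _ fun i _ => Measurable.sub ?_ ?_
  · exact Measurable.ite (measurableSet_lt (by fun_prop) (by fun_prop)) measurable_const
      measurable_const
  · split_ifs
    · exact measurable_const
    · exact Measurable.ite (measurableSet_lt (by fun_prop) measurable_const) measurable_const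
        measurable_const

theorem abs_primitiveKernel_factor_le (i : ℕ) (s t : ℝ) :
    |(if t < s then 1 else 0) - kernelShift m i t| ≤ if i < m then 1 / 2 else 1 := by
  unfold kernelShift
  split_ifs <;> norm_num [abs_le]

theorem abs_primitiveKernel_le (x y : Fin d → ℝ) :
    |primitiveKernel m x y| ≤ ∏ i : Fin d, if (i : ℕ) < m then (1 / 2 : ℝ) else 1 := by
  rw [primitiveKernel, Finset.abs_prod]
  exact Finset.prod_le_prod (fun _ _ => abs_nonneg _)
    fun i _ => abs_primitiveKernel_factor_le i _ _

theorem prod_ite_lt_half_one (hm : m ≤ d) :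
    (∏ i : Fin d, if (i : ℕ) < m then (1 / 2 : ℝ) else 1) = (2 ^ m)⁻¹ := by
  rw [Finset.prod_ite, Finset.prod_const, Finset.prod_const_one, mul_one,
    Fin.card_filter_val_lt, min_eq_right hm, one_div, inv_pow]

theorem abs_tentPrimitive_le (hm : m ≤ d) {h : ℝ} (hh : 0 < h) (x : Fin d → ℝ) :
    ‖tentPrimitive m h x‖ ≤ (2 ^ m)⁻¹ * (h ^ (d + 1) / (d + 1)) := by
  -- The orthant outside which the kernel vanishes for `y` in the cone: in a full-line coordinate
  -- the factor is nonzero only for `y i` between `0` and `x i`.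
  set I : Fin d → Set ℝ :=
    fun i => if (i : ℕ) < m ∨ 0 < x i then Set.Ici 0 else Set.Iic 0 with hI
  have hImeas : ∀ i, MeasurableSet (I i) := fun i => by
    simp only [hI]; split_ifs
    exacts [measurableSet_Ici, measurableSet_Iic]
  have hOmeas : MeasurableSet (Set.univ.pi I) := MeasurableSet.univ_pi hImeas
  have hO := setIntegral_pi_tent (I := I) (κ := fun _ => 1) (fun i s hs => by
    simp only [hI]
    split_ifs
    · exact volume_Ici_inter_Ioo s hs
    · exact volume_Iic_inter_Ioo s hs) hh
  rw [Finset.prod_const_one, one_mul] at hO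
  have hint : Integrable ((Set.univ.pi I).indicator fun y => (2 ^ m : ℝ)⁻¹ * tent d h y) :=
    ((integrable_tent h).const_mul _).indicator hOmeas
  calc ‖tentPrimitive m h x‖
      ≤ ∫ y in (cone d m : Set (Fin d → ℝ)),
          (Set.univ.pi I).indicator (fun y => (2 ^ m : ℝ)⁻¹ * tent d h y) y := by
        refine norm_integral_le_of_norm_le hint.restrict ?_
        filter_upwards [ae_restrict_mem (cone d m).isOpen.measurableSet] with y hy
        rw [norm_mul, Real.norm_of_nonneg (tent_nonneg h y)]
        by_cases hyO : y ∈ Set.univ.pi I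
        · rw [Set.indicator_of_mem hyO, ← prod_ite_lt_half_one hm]
          exact mul_le_mul_of_nonneg_right (abs_primitiveKernel_le x y) (tent_nonneg h y)
        · rw [Set.indicator_of_notMem hyO]
          simp only [Set.mem_univ_pi, not_forall] at hyO
          obtain ⟨i, hi⟩ := hyO
          have hzero : primitiveKernel m x y = 0 := by
            refine Finset.prod_eq_zero (Finset.mem_univ i) ?_
            have him : ¬ (i : ℕ) < m := fun him => hi (by
              simp only [hI, him, true_or, if_true]
              exact (hy i him).le)
            simp only [hI, him, false_or] at hi
            rw [kernelShift, if_neg him]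
            by_cases hx : 0 < x i
            · rw [if_pos hx, Set.mem_Ici, not_le] at hi
              rw [if_pos hi, if_pos (hi.trans hx), sub_self]
            · rw [if_neg hx, Set.mem_Iic, not_le] at hi
              rw [if_neg hi.not_gt, if_neg (by linarith), sub_self]
          rw [hzero]
          simp
    _ ≤ ∫ y, (Set.univ.pi I).indicator (fun y => (2 ^ m : ℝ)⁻¹ * tent d h y) y :=
        setIntegral_le_integral hint (.of_forall fun y =>
          Set.indicator_nonneg (fun y _ => mul_nonneg (by positivity) (tent_nonneg h y)) y)
    _ = _ := by rw [integral_indicator hOmeas, integral_const_mul, hO]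

theorem memLp_tentPrimitive (hm : m ≤ d) {h : ℝ} (hh : 0 < h) (μ : Measure (Fin d → ℝ)) :
    MemLp (tentPrimitive m h) ∞ μ := by
  refine memLp_top_of_bound ?_ _ (.of_forall (abs_tentPrimitive_le hm hh))
  have : Measurable fun p : (Fin d → ℝ) × (Fin d → ℝ) =>
      primitiveKernel m p.1 p.2 * tent d h p.2 :=
    measurable_primitiveKernel.mul ((continuous_tent h).measurable.comp measurable_snd)
  exact (this.stronglyMeasurable.integral_prod_right
    (ν := volume.restrict (cone d m : Set (Fin d → ℝ)))).aestronglyMeasurable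

/-- The shift depends on `y` only, so it does not affect differentiation in `x`. Concretely, it is
replaced by a multiple of a step at `-R`, which equals `1` on the support of the derivative; every
vertex having a coordinate `-R` lies outside the support of `φ`. -/
theorem integral_primitiveKernel_mul {Ω : Opens (Fin d → ℝ)} (φ : 𝓓(Ω, ℝ)) (y : Fin d → ℝ) :
    ∫ x, primitiveKernel m x y * (∂^{stdVec (d := d)} φ) x = (-1) ^ d * φ y := by
  obtain ⟨R, hR⟩ := ((φ.hasCompactSupport.isCompact.union
    (∂^{stdVec (d := d)} φ).hasCompactSupport.isCompact).isBounded).subset_ball 0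
  have hlow : ∀ x : Fin d → ℝ, x ∈ Metric.ball (0 : Fin d → ℝ) R → ∀ i, -R < x i := by
    intro x hx i
    rw [mem_ball_zero_iff] at hx
    have := (norm_le_pi_norm x i).trans_lt hx
    rw [Real.norm_eq_abs] at this
    exact (abs_lt.1 this).1
  have h := integral_prod_sum_step_mul φ
    (fun i s => if s then 1 else -kernelShift m i (y i)) (fun i s => if s then y i else -R)
  rw [Fintype.sum_eq_single (fun _ => true)] at h
  · simp only [if_true, Finset.prod_const_one, one_mul] at h
    rw [← h]
    refine integral_congr_ae (.of_forall fun x => ?_)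
    beta_reduce
    by_cases hx : (∂^{stdVec (d := d)} φ) x = 0
    · rw [hx, mul_zero, mul_zero]
    · have hxR := hlow x (hR (Or.inr (subset_tsupport _ hx)))
      congr 1
      refine Finset.prod_congr rfl fun i _ => ?_
      rw [Fintype.sum_bool]
      simp only [if_true, Bool.false_eq_true, if_false, hxR i]
      ring
  · intro σ hσ
    obtain ⟨i, hi⟩ : ∃ i, σ i ≠ true := by
      by_contra! hcon
      exact hσ (funext hcon)
    have hzero : φ (fun i => if σ i then y i else -R) = 0 := by
      by_contra hne
      have := hlow _ (hR (Or.inl (subset_tsupport _ hne))) i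
      simp [hi] at this
    rw [hzero, mul_zero]

theorem isMixedDeriv_tentPrimitive (hm : m ≤ d) {h : ℝ} (hh : 0 < h) :
    IsMixedDeriv (cone d m) ((memLp_tentPrimitive hm hh _).toLp) (tentLp (cone d m) hh.le) := by
  intro φ
  set C : Set (Fin d → ℝ) := (cone d m : Set (Fin d → ℝ)) with hC
  have hprod : Integrable (fun p : (Fin d → ℝ) × (Fin d → ℝ) =>
      primitiveKernel m p.1 p.2 * ((∂^{stdVec (d := d)} φ) p.1 * tent d h p.2))
      ((volume.restrict C).prod (volume.restrict C)) := by
    refine ((integrable_testFunction (∂^{stdVec (d := d)} φ)).restrict.mul_prod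
      (integrable_tent h).restrict).bdd_mul measurable_primitiveKernel.aestronglyMeasurable
      (.of_forall fun p => abs_primitiveKernel_le p.1 p.2)
  calc _ = ∫ x in C, tentPrimitive m h x * (∂^{stdVec (d := d)} φ) x := by
        refine integral_congr_ae ?_
        filter_upwards [(memLp_tentPrimitive hm hh (volume.restrict C)).coeFn_toLp] with x hx
        rw [hx]
    _ = ∫ x in C, ∫ y in C,
          primitiveKernel m x y * ((∂^{stdVec (d := d)} φ) x * tent d h y) := by
        refine integral_congr_ae (.of_forall fun x => ?_)
        beta_reduce
        rw [tentPrimitive, ← integral_mul_const]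
        refine integral_congr_ae (.of_forall fun y => ?_)
        ring
    _ = ∫ y in C, ∫ x in C,
          primitiveKernel m x y * ((∂^{stdVec (d := d)} φ) x * tent d h y) :=
        integral_integral_swap (f := fun x y =>
          primitiveKernel m x y * ((∂^{stdVec (d := d)} φ) x * tent d h y)) hprod
    _ = ∫ y in C, (-1) ^ d * (tentLp (cone d m) hh.le y * φ y) := by
        refine integral_congr_ae ?_
        filter_upwards [tentLp_ae_eq (cone d m) hh.le] with y hy
        simp only [← mul_assoc]
        rw [integral_mul_const, setIntegral_eq_integral_of_forall_compl_eq_zero fun x hx => by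
          rw [testFunction_eq_zero _ hx, mul_zero], integral_primitiveKernel_mul, hy]
        ring
    _ = _ := integral_const_mul _ _

theorem exists_extremal (hm : m ≤ d) {h : ℝ} (hh : 0 < h) :
    ∃ f ∈ mixedClass (cone d m), ‖f‖ ≤ (2 ^ m)⁻¹ * (h ^ (d + 1) / (d + 1)) ∧
      h ≤ ‖mixedDeriv (cone d m) f‖ := by
  have hmix := isMixedDeriv_tentPrimitive hm hh
  refine ⟨(memLp_tentPrimitive hm hh _).toLp, ⟨⟨_, fun i =>
    ⟨_, isPartialDeriv_tentLp _ hh.le i⟩, hmix⟩, ?_⟩, ?_, ?_⟩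
  · rw [hmix.mixedDeriv_eq]
    exact gradNorm_tentLp_le _ hh.le
  · refine Linfty.norm_le_of_ae (by positivity) ?_
    filter_upwards [(memLp_tentPrimitive hm hh _).coeFn_toLp] with x hx
    rw [hx]
    exact abs_tentPrimitive_le hm hh x
  · rw [hmix.mixedDeriv_eq]
    exact le_norm_tentLp hh.le

end Primitive

/-! ### Inequalities between the three extremal quantities. -/

section AbstractBounds

variable {X Y : Type*} [SeminormedAddCommGroup X] [NormedAddCommGroup Y]

theorem ofReal_le_modulus {A : X → Y} {M : Set X} {δ c : ℝ} {f : X} (hf : f ∈ M) (hδ : ‖f‖ ≤ δ)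
    (hc : c ≤ ‖A f‖) : ENNReal.ofReal c ≤ modulus A M δ := by
  refine le_iSup₂_of_le f hf (le_iSup_of_le hδ ?_)
  rw [← ofReal_norm]
  exact ENNReal.ofReal_le_ofReal hc

variable [NormedSpace ℝ X] [NormedSpace ℝ Y]

/-- If `‖x‖ ≤ δ`, then `η = 0` is admissible data for `x`, and a linear `S` sends it to `0`. -/
theorem modulus_le_optimalRecovery (A : X → Y) (M : Set X) (δ : ℝ) :
    modulus A M δ ≤ optimalRecovery A M δ := by
  refine le_iInf fun S => iSup₂_le fun x hx => iSup_le fun hδ => ?_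
  have h : ‖A x - S 0‖ₑ ≤ recoveryDeviation A S M δ :=
    le_iSup₂_of_le x hx (le_iSup₂_of_le 0 (by rwa [sub_zero]) le_rfl)
  rwa [map_zero, sub_zero] at h

/-- The error splits into the deviation on exact data and the effect `S (f - η)` of the noise. -/
theorem optimalRecovery_le_ofReal {A : X → Y} {M : Set X} (S : X →L[ℝ] Y) {N ε δ : ℝ}
    (hS : ‖S‖ ≤ N) (hN : 0 ≤ N) (h : ∀ f ∈ M, ‖A f - S f‖ ≤ ε) :
    optimalRecovery A M δ ≤ ENNReal.ofReal (ε + N * δ) := by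
  refine iInf_le_of_le S (iSup₂_le fun f hf => iSup₂_le fun η hη => ?_)
  rw [← ofReal_norm]
  refine ENNReal.ofReal_le_ofReal ?_
  calc ‖A f - S η‖ = ‖(A f - S f) + S (f - η)‖ := by rw [map_sub]; congr 1; abel
    _ ≤ ‖A f - S f‖ + ‖S (f - η)‖ := norm_add_le _ _
    _ ≤ ε + N * δ := by
        refine add_le_add (h f hf) ((S.le_opNorm _).trans ?_)
        exact mul_le_mul hS hη (norm_nonneg _) hN

theorem bestApprox_le_ofReal {A : X → Y} {M : Set X} (S : X →L[ℝ] Y) {N ε : ℝ}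
    (hS : ‖S‖ ≤ N) (h : ∀ f ∈ M, ‖A f - S f‖ ≤ ε) :
    bestApprox A M N ≤ ENNReal.ofReal ε := by
  refine iInf₂_le_of_le S hS (iSup₂_le fun f hf => ?_)
  rw [← ofReal_norm]
  exact ENNReal.ofReal_le_ofReal (h f hf)

theorem ofReal_le_bestApprox {A : X → Y} {M : Set X} {N δ c : ℝ} {f : X} (hf : f ∈ M)
    (hN : 0 ≤ N) (hδ : ‖f‖ ≤ δ) (hc : c ≤ ‖A f‖) :
    ENNReal.ofReal (c - N * δ) ≤ bestApprox A M N := by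
  refine le_iInf₂ fun S hS => le_iSup₂_of_le f hf ?_
  rw [← ofReal_norm]
  refine ENNReal.ofReal_le_ofReal ?_
  have h1 : ‖S f‖ ≤ N * δ := (S.le_opNorm f).trans (mul_le_mul hS hδ (norm_nonneg _) hN)
  linarith [norm_sub_norm_le (A f) (S f)]

end AbstractBounds

/-! ### The extremal quantities in terms of the step `h`. -/

section Main

variable {d m : ℕ}

theorem recovery_of_step (hm : m ≤ d) {h : ℝ} (hh : 0 < h) {δ : ℝ}
    (hδ : δ = (2 ^ m)⁻¹ * (h ^ (d + 1) / (d + 1))) :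
    optimalRecovery (mixedDeriv (cone d m)) (mixedClass (cone d m)) δ = ENNReal.ofReal h ∧
      modulus (mixedDeriv (cone d m)) (mixedClass (cone d m)) δ = ENNReal.ofReal h := by
  obtain ⟨f, hf, hfδ, hfh⟩ := exists_extremal hm hh
  obtain ⟨S, hS, hdev⟩ := exists_approx_mixedDeriv hm hh
  have hlow := ofReal_le_modulus hf (hfδ.trans_eq hδ.symm) hfh
  have hmid := modulus_le_optimalRecovery (mixedDeriv (cone d m)) (mixedClass (cone d m)) δ
  have hup := optimalRecovery_le_ofReal (δ := δ) S hS (by positivity) hdev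
  -- The noise term equals `h / (d + 1)`, exactly what the deviation lacks to reach `h`; so the
  -- upper and lower bounds coincide.
  have heq : d / (d + 1) * h + 2 ^ m / h ^ d * δ = h := by
    rw [hδ]
    have : (d : ℝ) + 1 ≠ 0 := by positivity
    field_simp
    ring
  rw [heq] at hup
  exact ⟨hup.antisymm (hlow.trans hmid), (hmid.trans hup).antisymm hlow⟩

theorem bestApprox_of_step (hm : m ≤ d) {h : ℝ} (hh : 0 < h) :
    bestApprox (mixedDeriv (cone d m)) (mixedClass (cone d m)) (2 ^ m / h ^ d) =
      ENNReal.ofReal (d / (d + 1) * h) := by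
  obtain ⟨f, hf, hfδ, hfh⟩ := exists_extremal hm hh
  obtain ⟨S, hS, hdev⟩ := exists_approx_mixedDeriv hm hh
  refine (bestApprox_le_ofReal S hS hdev).antisymm ?_
  have hlow := ofReal_le_bestApprox (N := 2 ^ m / h ^ d) hf (by positivity) hfδ hfh
  have heq : h - 2 ^ m / h ^ d * ((2 ^ m)⁻¹ * (h ^ (d + 1) / (d + 1))) = d / (d + 1) * h := by
    have : (d : ℝ) + 1 ≠ 0 := by positivity
    field_simp
    ring
  rwa [heq] at hlow

end Main

end Stechkin

end

theorem theorem6 (d : ℕ) (hd : 1 ≤ d) (m : ℕ) (hm : m = 0 ∨ m = 1) :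
    (∀ δ : ℝ, 0 < δ →
      Stechkin.optimalRecovery (Stechkin.mixedDeriv (Stechkin.cone d m))
          (Stechkin.mixedClass (Stechkin.cone d m)) δ =
        ENNReal.ofReal ((2 ^ m * ((d : ℝ) + 1) * δ) ^ (1 / ((d : ℝ) + 1))) ∧
      Stechkin.modulus (Stechkin.mixedDeriv (Stechkin.cone d m))
          (Stechkin.mixedClass (Stechkin.cone d m)) δ =
        ENNReal.ofReal ((2 ^ m * ((d : ℝ) + 1) * δ) ^ (1 / ((d : ℝ) + 1)))) ∧
    (∀ N : ℝ, 0 < N →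
      Stechkin.bestApprox (Stechkin.mixedDeriv (Stechkin.cone d m))
          (Stechkin.mixedClass (Stechkin.cone d m)) N =
        ENNReal.ofReal ((d : ℝ) / ((d : ℝ) + 1) * (2 ^ m / N) ^ (1 / (d : ℝ)))) := by
  have hmd : m ≤ d := by omega
  refine ⟨fun δ hδ => ?_, fun N hN => ?_⟩
  · have hbase : 0 < 2 ^ m * ((d : ℝ) + 1) * δ := by positivity
    -- The step solves `h^(d+1) = 2^m (d+1) δ`.
    refine Stechkin.recovery_of_step hmd (Real.rpow_pos_of_pos hbase _) ?_
    have hpow := Real.rpow_inv_natCast_pow hbase.le d.succ_ne_zero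
    rw [Nat.cast_succ] at hpow
    rw [one_div, hpow]
    field_simp
  · have hbase : 0 < 2 ^ m / N := by positivity
    -- The step solves `2^m / h^d = N`.
    have h := Stechkin.bestApprox_of_step hmd (Real.rpow_pos_of_pos hbase (1 / (d : ℝ)))
    have hN' : 2 ^ m / ((2 ^ m / N) ^ (1 / (d : ℝ))) ^ d = N := by
      rw [one_div, Real.rpow_inv_natCast_pow hbase.le (by omega)]
      field_simp
    rwa [hN'] at h
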